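/- **Setting.** A contextual decision process (CDP) has a context space $\mathcal X$, a finite action set $\mathcal A$ with $K=|\mathcal A|\ge 1$, a horizon $H\ge 1$, an initial law $x_1\sim P_\varnothing$, and $(r_h,x_{h+1})\sim P_+(x_1,a_1,r_1,\dots,x_h,a_h)$. However actions are chosen, almost surely $r_h\ge 0$ for all $h$ and $\sum_{h=1}^H r_h\le 1$. A policy $\pi:\mathcal X\to\mathcal A$ has value $V^\pi=\mathbb E[\sum_{h=1}^H r_h\mid a_{1:H}\sim\pi]$. Let $\mathcal F$ be a finite class of $N$ functions $f:\mathcal X\times\mathcal A\to[0,1]$, with $f(x_{H+1},\cdot)=0$ by convention and greedy policies $\pi_f(x)\in\arg\max_a f(x,a)$. Put $$\mathcal E(f,\pi,h)=\mathbb E\big[f(x_h,a_h)-r_h-f(x_{h+1},a_{h+1})\mid a_{1:h-1}\sim\pi,\ a_{h:h+1}\sim\pi_f\big].$$ Call $f$ $\theta$-valid if $|\mathcal E(f,\pi_{f'},h)|\le\theta$ for all $f'\in\mathcal F$, $h\in[H]$, assume that a $\theta$-valid $f\in\mathcal F$ exists, and let $V^\star_\theta=\max\{V^{\pi_f}: f\in\mathcal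 F\ \theta\text{-valid}\}$. The CDP and $\mathcal F$ admit a Bellman factorization with rank $M\ge1$, norm parameter $\zeta$ and approximation error $\eta$ if there are $\nu_h,\xi_h:\mathcal F\to\mathbb R^M$ with $|\mathcal E(f,\pi_{f'},h)-\langle\nu_h(f'),\xi_h(f)\rangle|\le\eta$ and $\|\nu_h(f')\|_2\|\xi_h(f)\|_2\le\zeta$ for all $f,f'\in\mathcal F$, $h\in[H]$. **Algorithm OLIVER.** Parameters (sample sizes rounded up), with $L=6H\sqrt M\zeta/\varepsilon$: $\varepsilon'=\varepsilon+2H(3\sqrt M(\theta+\eta)+\eta)$, $$\phi=\tfrac{\varepsilon}{12H\sqrt M},\quad n_{\rm est}=\tfrac{32}{\varepsilon^2}\log\tfrac{6N}{\delta},\quad n_{\rm eval}=\tfrac{288H^2}{\varepsilon^2}\log\tfrac{12H^2M\log L}{\delta},\quad n=\tfrac{4608H^2MK}{\varepsilon^2}\log\tfrac{12NHM\log L}{\delta}.$$ Collect $n_{\rm est}$ episodes, keep their initial contexts $x_1^{(i)}$ and set $\hat V_f=\frac1{n_{\rm est}}\sum_i f(x_1^{(i)},\pi_f(x_1^{(i)}))$,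 $\mathcal F_0=\mathcal F$. For $t=1,2,\dots$: (a) choose $f_t\in\arg\max_{f\in\mathcal F_{t-1}}\hat V_f$ and put $\pi_t=\pi_{f_t}$; (b) collect $n_{\rm eval}$ fresh episodes with $\pi_t$, and let $\tilde{\mathcal E}_h$ be the empirical average of $f_t(x_h,a_h)-r_h-f_t(x_{h+1},a_{h+1})$, for each $h\in[H]$; (c) if $\sum_h\tilde{\mathcal E}_h\le 5\varepsilon'/8$, halt and return $\pi_t$; (d) otherwise pick any $h_t$ with $\tilde{\mathcal E}_{h_t}\ge 5\varepsilon'/(8H)$ and collect $n$ fresh episodes with $\pi_t$, except that $a_{h_t}$ is uniformly random; (e) let $\hat{\mathcal E}(f)$ be the empirical average over these of $K\,\mathbf 1[a_{h_t}=\pi_f(x_{h_t})]\,\big(f(x_{h_t},a_{h_t})-r_{h_t}-f(x_{h_t+1},\pi_f(x_{h_t+1}))\big)$, and set $\mathcal F_t=\{f\in\mathcal F_{t-1}:|\hat{\mathcal E}(f)|\le\phi+\theta\}$. All choices left open may be randomized and may depend on everything observed so far. **Theorem.** There are universal constants $c,k$ such that the following holds. Let $\varepsilon,\delta\in(0,1)$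 and $\theta\in[0,1]$, let a CDP and a class $\mathcal F$ as above admit a Bellman factorization with parameters $M,\zeta,\eta$, and let $\zeta$ be large enough that $6H\sqrt M\zeta/\varepsilon\ge e$ (which can always be achieved by enlarging $\zeta$). Then with probability at least $1-\delta$, OLIVER halts, returns a policy $\hat\pi$ with $$V^{\hat\pi}\ \ge\ V^\star_\theta-\big(\varepsilon+8H\sqrt M(\theta+\eta)\big),$$ and uses at most $$c\,\frac{M^2H^3K}{\varepsilon^2}\,\log\!\Big(2+\frac{N\zeta}{\delta}\Big)\,\log^k\!\Big(2+\frac{MH(1+\zeta)}{\varepsilon}\Big)$$ episodes, that is, $\tilde O\big(\frac{M^2H^3K}{\varepsilon^2}\log(N\zeta/\delta)\big)$ episodes. -/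

import Mathlib

open MeasureTheory ProbabilityTheory
open scoped ENNReal

universe u v w

noncomputable section

/-! ## Contextual decision processes -/

/-- Interaction up to level `h` (levels are numbered from `0`): the `h` completed triples
(context, action, reward), together with the context that is observed next. -/
abbrev Hist (X : Type u) (A : Type v) (h : ℕ) : Type (max u v) :=
  (Fin h → X × A × ℝ) × X

/-- A finite-horizon contextual decision process with context space `X`, action space `A`,
horizon `H`, initial context law `init`, and for every history that ends with an action the law
`step` of the next reward and context. -/
structure CDP (X : Type u) (A : Type v) [MeasurableSpace X] [MeasurableSpace A] where
  H : ℕ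
  init : Measure X
  init_prob : IsProbabilityMeasure init
  step : (h : ℕ) → Kernel (Hist X A h × A) (ℝ × X)
  step_markov : ∀ h, IsMarkovKernel (step h)

/-- Deterministic policies `X → A`. -/
abbrev Policy (X : Type u) (A : Type v) [MeasurableSpace X] [MeasurableSpace A] :
    Type (max u v) :=
  {π : X → A // Measurable π}

/-- A way of choosing actions: at each level a law of the action given the whole history. -/
abbrev Behavior (X : Type u) (A : Type v) [MeasurableSpace X] [MeasurableSpace A] :
    Type (max u v) :=
  (h : ℕ) → Kernel (Hist X A h) A

section Behaviors

variable {X : Type u} {A : Type v} [MeasurableSpace X] [MeasurableSpace A]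

/-- The action prescribed by `π` on the current context. -/
def actKernel (π : Policy X A) (h : ℕ) : Kernel (Hist X A h) A :=
  Kernel.deterministic (fun s => π.1 s.2) (π.2.comp measurable_snd)

/-- Follow `π` at every level. -/
def follow (π : Policy X A) : Behavior X A := fun h => actKernel π h

/-- Follow `π` at the levels before `h` and `π₂` from level `h` on. -/
def rollIn (π π₂ : Policy X A) (h : ℕ) : Behavior X A :=
  fun l => if l < h then actKernel π l else actKernel π₂ l

/-- Follow `π`, except that the action at level `h` is drawn uniformly at random. -/
def explore [Fintype A] [Nonempty A] (π : Policy X A) (h : ℕ) : Behavior X A :=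
  fun l => if l = h then Kernel.const _ (PMF.uniformOfFintype A).toMeasure else actKernel π l

end Behaviors

namespace CDP

variable {X : Type u} {A : Type v} [MeasurableSpace X] [MeasurableSpace A] (C : CDP X A)

/-- Law of the history up to level `h` when actions are chosen according to `σ`. -/
def histLaw (σ : Behavior X A) : (h : ℕ) → Measure (Hist X A h)
  | 0 => C.init.map fun x => (Fin.elim0, x)
  | h + 1 => (histLaw σ h ⊗ₘ (σ h ⊗ₖ C.step h)).map fun z =>
      (Fin.snoc (α := fun _ => X × A × ℝ) z.1.1 (z.1.2, z.2.1, z.2.2.1), z.2.2.2)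

/-- Trajectories `(x₁, a₁, r₁, …, x_H, a_H, r_H, x_{H+1})`. -/
abbrev Traj : Type (max u v) := Hist X A C.H

/-- Law of a trajectory when actions are chosen according to `σ`. -/
def trajLaw (σ : Behavior X A) : Measure C.Traj := C.histLaw σ C.H

/-- Regardless of how actions are chosen, almost surely the rewards are non-negative and sum to
at most one. -/
def BoundedRewards : Prop :=
  ∀ σ : Behavior X A, (∀ h, IsMarkovKernel (σ h)) →
    ∀ᵐ τ ∂C.trajLaw σ, (∀ h, 0 ≤ (τ.1 h).2.2) ∧ ∑ h, (τ.1 h).2.2 ≤ 1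

/-- The value `V^π`. -/
def value (π : Policy X A) : ℝ := ∫ τ, ∑ h, (τ.1 h).2.2 ∂C.trajLaw (follow π)

end CDP

/-! ## Function classes and Bellman errors -/

/-- A family, indexed by `F`, of measurable functions `X × A → [0,1]`, each with its greedy policy
(an arbitrary, but fixed, way of breaking ties in the maximum over actions). -/
structure QClass (X : Type u) (A : Type v) (F : Type w) [MeasurableSpace X] [MeasurableSpace A]
    where
  q : F → X → A → ℝ
  q_measurable : ∀ f, Measurable fun p : X × A => q f p.1 p.2
  q_mem : ∀ f x a, q f x a ∈ Set.Icc (0 : ℝ) 1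
  greedy : F → Policy X A
  greedy_max : ∀ f x a, q f x a ≤ q f x ((greedy f).1 x)

namespace CDP

variable {X : Type u} {A : Type v} {F : Type w} [MeasurableSpace X] [MeasurableSpace A]
  (C : CDP X A) (Q : QClass X A F)

/-- `f(x_h, a_h) - r_h - f(x_{h+1}, a_{h+1})` along a trajectory. Values of `f` after the last
level are zero by convention. -/
def residual (f : F) (h : Fin C.H) (τ : C.Traj) : ℝ :=
  Q.q f (τ.1 h).1 (τ.1 h).2.1 - (τ.1 h).2.2 -
    if hh : (h : ℕ) + 1 < C.H then Q.q f (τ.1 ⟨h + 1, hh⟩).1 (τ.1 ⟨h + 1, hh⟩).2.1 else 0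

/-- The average Bellman error of `f` under roll-in policy `π` at level `h`: actions before level
`h` follow `π`, and those from level `h` on follow the greedy policy of `f`. -/
def bellmanError (f : F) (π : Policy X A) (h : Fin C.H) : ℝ :=
  ∫ τ, C.residual Q f h τ ∂C.trajLaw (rollIn π (Q.greedy f) h)

/-- `f` is `θ`-valid. -/
def IsValid (θ : ℝ) (f : F) : Prop :=
  ∀ (f₂ : F) (h : Fin C.H), |C.bellmanError Q f (Q.greedy f₂) h| ≤ θ

/-- The largest value of a greedy policy of a `θ`-valid function. -/
def optValue (θ : ℝ) : ℝ := ⨆ f : {f : F // C.IsValid Q θ f}, C.value (Q.greedy f)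

/-- Bellman factorization with Bellman rank `M`, norm parameter `ζ` and approximation
error `η`. -/
def HasBellmanFactorization (M : ℕ) (ζ η : ℝ) : Prop :=
  ∃ p b : Fin C.H → F → EuclideanSpace ℝ (Fin M), ∀ (h : Fin C.H) (f f₂ : F),
    |C.bellmanError Q f (Q.greedy f₂) h - inner ℝ (p h f₂) (b h f)| ≤ η ∧
      ‖p h f₂‖ * ‖b h f‖ ≤ ζ

end CDP

/-! ## The algorithm -/

/-- Sample sizes and thresholds of the algorithm. -/
structure OliverParams where
  nEst : ℕ
  nEval : ℕ
  nExpl : ℕ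
  φ : ℝ
  θ : ℝ
  εStop : ℝ

/-- The prescribed parameters for horizon `H`, `K` actions, `N` functions, Bellman rank `M`, norm
parameter `ζ` and approximation errors `θ`, `η`; sample sizes are rounded up. -/
def oliverParams (H K N M : ℕ) (ζ θ η ε δ : ℝ) : OliverParams where
  nEst := ⌈32 / ε ^ 2 * Real.log (6 * N / δ)⌉₊
  nEval := ⌈288 * H ^ 2 / ε ^ 2 *
    Real.log (12 * H ^ 2 * M * Real.log (6 * H * √M * ζ / ε) / δ)⌉₊
  nExpl := ⌈4608 * H ^ 2 * M * K / ε ^ 2 *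
    Real.log (12 * N * H * M * Real.log (6 * H * √M * ζ / ε) / δ)⌉₊
  φ := ε / (12 * H * √M)
  θ := θ
  εStop := ε + 2 * H * (3 * √M * (θ + η) + η)

namespace Oliver

variable {X : Type u} {A : Type v} {F : Type w} [MeasurableSpace X] [MeasurableSpace A]
  (C : CDP X A) (Q : QClass X A F) (P : OliverParams)

/-- What one iteration adds to the transcript: the chosen function, the trajectories collected
with its greedy policy, the chosen level, and the exploration trajectories. -/
abbrev Iter : Type (max u v w) :=
  F × (Fin P.nEval → C.Traj) × Fin C.H × (Fin P.nExpl → C.Traj)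

/-- The transcript of the first `T` iterations, including the initial contexts collected before
the first one. -/
abbrev Transcript (T : ℕ) : Type (max u v w) :=
  (Fin P.nEst → X) × (Fin T → Iter (F := F) C P)

variable {C P}

/-- The estimate of the predicted value of `f` from the initial contexts. -/
def estValue (f : F) (x : Fin P.nEst → X) : ℝ :=
  1 / (P.nEst : ℝ) * ∑ i, Q.q f (x i) ((Q.greedy f).1 (x i))

/-- The estimate, from trajectories of the greedy policy of `f`, of the Bellman error of `f` at
level `h` under this policy. -/
def estOwnError (f : F) (h : Fin C.H) (d : Fin P.nEval → C.Traj) : ℝ :=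
  1 / (P.nEval : ℝ) * ∑ i, C.residual Q f h (d i)

/-- The summand of the importance-weighted estimate of a Bellman error of `f` at level `h`. -/
def weightedResidual [Fintype A] [DecidableEq A] (f : F) (h : Fin C.H) (τ : C.Traj) : ℝ :=
  (if (τ.1 h).2.1 = (Q.greedy f).1 (τ.1 h).1 then (1 : ℝ) else 0) / (1 / (Fintype.card A : ℝ)) *
    (Q.q f (τ.1 h).1 (τ.1 h).2.1 - (τ.1 h).2.2 -
      if hh : (h : ℕ) + 1 < C.H then
        Q.q f (τ.1 ⟨h + 1, hh⟩).1 ((Q.greedy f).1 (τ.1 ⟨h + 1, hh⟩).1)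
      else 0)

/-- The importance-weighted estimate of the Bellman error of `f` at level `h` from exploration
trajectories. -/
def estError [Fintype A] [DecidableEq A] (f : F) (h : Fin C.H) (d : Fin P.nExpl → C.Traj) : ℝ :=
  1 / (P.nExpl : ℝ) * ∑ i, weightedResidual Q f h (d i)

/-- The functions that survive the first `t` iterations of a transcript. -/
def alive [Fintype A] [DecidableEq A] {T : ℕ} (r : Transcript (F := F) C P T) (t : ℕ) : Set F :=
  {f | ∀ s : Fin T, (s : ℕ) < t → |estError Q f (r.2 s).2.2.1 (r.2 s).2.2.2| ≤ P.φ + P.θ}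

/-- The termination test on the chosen function and its trajectories. -/
def Stop (f : F) (d : Fin P.nEval → C.Traj) : Prop :=
  ∑ h, estOwnError Q f h d ≤ 5 * P.εStop / 8

variable (C P)

/-- How the choices left open by the algorithm are made: `pick` selects a maximizer of the
estimated value among the surviving functions, and `level` selects a level at which the estimated
Bellman error is large when the test is not passed. Both may be randomized and may depend on
everything that has been observed so far. -/
structure Selection [Fintype A] [DecidableEq A] [MeasurableSpace F] where
  pick : (t : ℕ) → Kernel (Transcript (F := F) C P t) F
  pick_markov : ∀ t, IsMarkovKernel (pick t)
  pick_spec : ∀ (t : ℕ) (r : Transcript (F := F) C P t), (alive Q r t).Nonempty →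
    ∀ᵐ f ∂pick t r, f ∈ alive Q r t ∧ ∀ g ∈ alive Q r t, estValue Q g r.1 ≤ estValue Q f r.1
  level : (t : ℕ) →
    Kernel ((Transcript (F := F) C P t × F) × (Fin P.nEval → C.Traj)) (Fin C.H)
  level_markov : ∀ t, IsMarkovKernel (level t)
  level_spec : ∀ (t : ℕ) (r : Transcript (F := F) C P t) (f : F) (d : Fin P.nEval → C.Traj),
    ¬ Stop Q f d → ∀ᵐ h ∂level t ((r, f), d), 5 * P.εStop / (8 * C.H) ≤ estOwnError Q f h d

section Law

variable [Fintype A] [DecidableEq A] [Nonempty A] [MeasurableSpace F] [Countable F]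
  [MeasurableSingletonClass F]

/-- Independent trajectories that follow the greedy policy of the chosen function. -/
def evalKernel : Kernel F (Fin P.nEval → C.Traj) :=
  Kernel.ofFunOfCountable fun f => Measure.pi fun _ => C.trajLaw (follow (Q.greedy f))

/-- Independent trajectories that follow the greedy policy of the chosen function except for a
uniformly random action at the chosen level. -/
def explKernel : Kernel (F × Fin C.H) (Fin P.nExpl → C.Traj) :=
  Kernel.ofFunOfCountable fun p =>
    Measure.pi fun _ => C.trajLaw (explore (Q.greedy p.1) p.2)

variable {C Q P}

set_option synthInstance.maxSize 1024 in
/-- One iteration of the algorithm, given the transcript so far: choose a function, collect fresh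
evaluation trajectories, choose a level, collect fresh exploration trajectories. -/
def iterKernel (S : Selection C Q P) (t : ℕ) :
    Kernel (Transcript (F := F) C P t) (Iter (F := F) C P) :=
  S.pick t ⊗ₖ
    ((evalKernel C Q P).comap Prod.snd measurable_snd ⊗ₖ
      (S.level t ⊗ₖ
        (explKernel C Q P).comap (fun z => (z.1.1.2, z.2))
          ((measurable_snd.comp (measurable_fst.comp measurable_fst)).prodMk measurable_snd)))

set_option synthInstance.maxSize 1024 in
/-- The law of the transcript of the first `T` iterations. What is recorded after the termination
test has been passed plays no role. -/
def runLaw (S : Selection C Q P) : (T : ℕ) → Measure (Transcript (F := F) C P T)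
  | 0 => (Measure.pi fun _ : Fin P.nEst => C.init).map fun x => (x, Fin.elim0)
  | T + 1 => (runLaw S T ⊗ₘ iterKernel S T).map fun z =>
      (z.1.1, Fin.snoc (α := fun _ => Iter (F := F) C P) z.1.2 z.2)

end Law

variable {C P}

/-- The algorithm halts in iteration `t` (iterations are numbered from `0`): it gets there with a
function left to choose, and passes the termination test there for the first time. -/
def HaltsAt [Fintype A] [DecidableEq A] {T : ℕ} (r : Transcript (F := F) C P T) (t : Fin T) :
    Prop :=
  (alive Q r t).Nonempty ∧ Stop Q (r.2 t).1 (r.2 t).2.1 ∧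
    ∀ s : Fin T, s < t → ¬ Stop Q (r.2 s).1 (r.2 s).2.1

/-- The policy returned when the algorithm halts in iteration `t`. -/
def output {T : ℕ} (r : Transcript (F := F) C P T) (t : Fin T) : Policy X A :=
  Q.greedy (r.2 t).1

/-- The number of episodes used when the algorithm halts in iteration `t`: the initial ones,
`t + 1` evaluation rounds and `t` exploration rounds. -/
def episodes (P : OliverParams) (t : ℕ) : ℕ := P.nEst + (t + 1) * P.nEval + t * P.nExpl

end Oliver

end

/-! The proof separates probability from a deterministic analysis of good runs, in which every
empirical mean is within its tolerance and every free choice meets its specification. The data of an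
iteration are fresh given the chosen function and level, so Hoeffding and Bernstein bounds hold
conditionally on the past, however the choices were made. Transcripts are recorded for a fixed
number `T` of iterations, including those after halting. No stopping time is needed, and a union
bound over the iterations (`runLaw_not_runGood_le`) suffices.

In a good run a valid function is never eliminated. Along its own greedy policy the Bellman errors
of `f` telescope to predicted value minus true value (`sum_bellmanError_greedy`). If the test passes
in iteration `t`, then `f_t` overestimates its own value only slightly. By optimism its predicted
value is, up to sampling error, at least that of any valid `f`, which in turn is at least the value
of `π_f` minus `Hθ`. Hence the returned policy is near-optimal (`RunGood.value_ge_of_stop`).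

If the test fails, `f_t` has a large Bellman error at level `h_t` under its own roll-in, yet it
survived all earlier eliminations at that level, so its errors under those earlier roll-ins are
small. Through the factorization these are vectors in dimension `M` with `⟨p_s, x_t⟩` small for `s <
t` and `⟨p_t, x_t⟩` larger by a factor `3√M`. An ellipsoid potential (`card_le_of_dotProduct_gap`)
allows this only `2M log L` times per level, hence `2HM log L` times in all. This bounds the number
of iterations and fixes `T`.

The dependence on `K` is linear because the importance-weighted residual is unbiased with second
moment at most `4K`, although its range is of order `K`; Bernstein's inequality exploits this. -/

/-! ## Concentration of empirical means -/

section Concentration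

variable {Ω : Type*} [MeasurableSpace Ω] {μ : Measure Ω} [IsProbabilityMeasure μ]

/-- Chernoff bound for the empirical mean of independent samples. -/
theorem chernoff_empiricalMean {n : ℕ} (hn : 0 < n) {g : Ω → ℝ}
    {m v l s : ℝ} (hl : 0 ≤ l) (hint : Integrable (fun x => Real.exp (l * (g x - m))) μ)
    (hmgf : ∫ x, Real.exp (l * (g x - m)) ∂μ ≤ Real.exp v) :
    Measure.pi (fun _ : Fin n => μ) {d | s ≤ 1 / (n : ℝ) * ∑ i, g (d i) - m} ≤
      ENNReal.ofReal (Real.exp (-(n * (l * s - v)))) := by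
  have hn' : (0 : ℝ) < n := by exact_mod_cast hn
  have key : ∀ d : Fin n → Ω,
      Real.exp (l * ∑ i, (g (d i) - m)) = ∏ i, Real.exp (l * (g (d i) - m)) := by
    intro d; rw [Finset.mul_sum, Real.exp_sum]
  have hset : {d : Fin n → Ω | s ≤ 1 / (n : ℝ) * ∑ i, g (d i) - m} =
      {d | n * s ≤ ∑ i, (g (d i) - m)} := by
    ext d
    simp only [Set.mem_ofPred_eq, Finset.sum_sub_distrib, Finset.sum_const, Finset.card_univ,
      Fintype.card_fin, nsmul_eq_mul]
    rw [← mul_le_mul_iff_right₀ hn']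
    have : (n : ℝ) * (1 / n * ∑ i, g (d i) - m) = ∑ i, g (d i) - n * m := by field_simp
    rw [this]
  have hI : Integrable (fun d : Fin n → Ω => Real.exp (l * ∑ i, (g (d i) - m)))
      (Measure.pi fun _ => μ) := by
    simp_rw [key]
    exact Integrable.fintype_prod (f := fun _ x => Real.exp (l * (g x - m))) fun _ => hint
  have h := measure_ge_le_exp_mul_mgf (μ := Measure.pi (fun _ : Fin n => μ))
    (X := fun d => ∑ i, (g (d i) - m)) (n * s) hl hI
  have hm : mgf (fun d : Fin n → Ω => ∑ i, (g (d i) - m)) (Measure.pi fun _ => μ) l ≤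
      Real.exp (n * v) := by
    unfold mgf
    simp_rw [key]
    rw [integral_fintype_prod_eq_prod (μ := fun _ : Fin n => μ)
      (fun (_ : Fin n) x => Real.exp (l * (g x - m)))]
    rw [Finset.prod_const, Finset.card_univ, Fintype.card_fin, Real.exp_nat_mul]
    exact pow_le_pow_left₀ (integral_nonneg fun _ => (Real.exp_pos _).le) hmgf n
  rw [hset, ← ofReal_measureReal]
  apply ENNReal.ofReal_le_ofReal
  refine h.trans ?_
  refine (mul_le_mul_of_nonneg_left hm (Real.exp_pos _).le).trans ?_
  rw [← Real.exp_add]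
  apply Real.exp_le_exp.2
  nlinarith

/-- Two-sided version of the Chernoff bound. -/
theorem chernoff_empiricalMean_abs {n : ℕ} (hn : 0 < n) {g : Ω → ℝ}
    {m v l s : ℝ} (hl : 0 ≤ l)
    (hint : ∀ k : ℝ, |k| = l → Integrable (fun x => Real.exp (k * (g x - m))) μ)
    (hmgf : ∀ k : ℝ, |k| = l → ∫ x, Real.exp (k * (g x - m)) ∂μ ≤ Real.exp v) :
    Measure.pi (fun _ : Fin n => μ) {d | ¬ |1 / (n : ℝ) * ∑ i, g (d i) - m| ≤ s} ≤
      2 * ENNReal.ofReal (Real.exp (-(n * (l * s - v)))) := by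
  have h1 := chernoff_empiricalMean (s := s) hn hl (hint l (abs_of_nonneg hl))
    (hmgf l (abs_of_nonneg hl))
  have e : ∀ x, l * (-g x - -m) = (-l) * (g x - m) := fun x => by ring
  have h2 := chernoff_empiricalMean (μ := μ) (m := -m) (v := v) (s := s) (g := -g) hn hl
    (by simpa only [Pi.neg_apply, e] using hint (-l) (by rw [abs_neg, abs_of_nonneg hl]))
    (by simpa only [Pi.neg_apply, e] using hmgf (-l) (by rw [abs_neg, abs_of_nonneg hl]))
  rw [two_mul]
  refine (measure_mono ?_).trans ((measure_union_le _ _).trans (add_le_add h1 h2))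
  intro d hd
  simp only [Set.mem_ofPred_eq, not_le, lt_abs] at hd
  rcases hd with hd | hd
  · exact Or.inl hd.le
  · right
    simp only [Set.mem_ofPred_eq, Pi.neg_apply, Finset.sum_neg_distrib]
    linarith

/-- Hoeffding's inequality. -/
theorem hoeffding_empiricalMean {n : ℕ} (hn : 0 < n) {g : Ω → ℝ} (hg : Measurable g)
    {a b s : ℝ} (hab : a < b) (hs : 0 ≤ s) (hb : ∀ᵐ x ∂μ, g x ∈ Set.Icc a b) :
    Measure.pi (fun _ : Fin n => μ) {d | ¬ |1 / (n : ℝ) * ∑ i, g (d i) - ∫ x, g x ∂μ| ≤ s} ≤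
      2 * ENNReal.ofReal (Real.exp (-(n * (2 * s ^ 2 / (b - a) ^ 2)))) := by
  have hab' : 0 < b - a := sub_pos.2 hab
  have hsub := hasSubgaussianMGF_of_mem_Icc hg.aemeasurable hb
  -- This maximizes `l * s - l ^ 2 * (b - a) ^ 2 / 8`, the exponent left by Hoeffding's lemma.
  set l : ℝ := 4 * s / (b - a) ^ 2 with hl
  have h := chernoff_empiricalMean_abs (s := s) (l := l) (v := l ^ 2 * (b - a) ^ 2 / 8) hn
    (by positivity) (fun k _ => hsub.integrable_exp_mul k) (fun k hk => by
      refine (hsub.mgf_le k).trans (Real.exp_le_exp.2 (le_of_eq ?_))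
      have : k ^ 2 = l ^ 2 := by rw [← hk, sq_abs]
      rw [this]
      push_cast
      rw [Real.norm_eq_abs, abs_of_pos hab']
      ring)
  refine h.trans (le_of_eq ?_)
  congr 4
  rw [hl]
  field_simp
  ring

/-- A Bernstein-type inequality, for small deviations. -/
theorem bernstein_empiricalMean {n : ℕ} (hn : 0 < n) {g : Ω → ℝ} (hg : Measurable g)
    {B V s : ℝ} (hV : 0 < V) (hs : 0 ≤ s) (hsB : s * B ≤ 2 * V)
    (hb : ∀ᵐ x ∂μ, |g x| ≤ B) (hv : ∫ x, g x ^ 2 ∂μ ≤ V) :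
    Measure.pi (fun _ : Fin n => μ) {d | ¬ |1 / (n : ℝ) * ∑ i, g (d i) - ∫ x, g x ∂μ| ≤ s} ≤
      2 * ENNReal.ofReal (Real.exp (-(n * (s ^ 2 / (4 * V))))) := by
  set m := ∫ x, g x ∂μ with hm
  -- The maximizer of `l * s - l ^ 2 * V`. The hypothesis `s * B ≤ 2 * V` says exactly that `l * B ≤
  -- 1`, which the quadratic bound on the exponential needs.
  set l : ℝ := s / (2 * V) with hl
  have hl0 : 0 ≤ l := by positivity
  have hgi : Integrable g μ :=
    Integrable.of_bound hg.aestronglyMeasurable B (by simpa only [Real.norm_eq_abs] using hb)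
  have hg2 : Integrable (fun x => g x ^ 2) μ := by
    refine Integrable.of_bound (hg.pow_const 2).aestronglyMeasurable (B ^ 2) ?_
    filter_upwards [hb] with x hx
    rw [Real.norm_eq_abs, abs_pow]
    exact pow_le_pow_left₀ (abs_nonneg _) hx 2
  have hsmall : ∀ k : ℝ, |k| = l → ∀ᵐ x ∂μ, |k * g x| ≤ 1 := by
    intro k hk
    filter_upwards [hb] with x hx
    rw [abs_mul, hk]
    refine (mul_le_mul_of_nonneg_left hx hl0).trans ?_
    rw [hl, div_mul_eq_mul_div]
    exact div_le_one_of_le₀ hsB (by positivity)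
  have hexp : ∀ k : ℝ, |k| = l → Integrable (fun x => Real.exp (k * g x)) μ := by
    intro k hk
    refine Integrable.of_bound (by fun_prop) (Real.exp 1) ?_
    filter_upwards [hsmall k hk] with x hx
    rw [Real.norm_eq_abs, abs_of_pos (Real.exp_pos _)]
    exact Real.exp_le_exp.2 ((le_abs_self _).trans hx)
  have e : ∀ k x, Real.exp (k * (g x - m)) = Real.exp (-(k * m)) * Real.exp (k * g x) := by
    intro k x; rw [← Real.exp_add]; congr 1; ring
  have h := chernoff_empiricalMean_abs (μ := μ) (g := g) (m := m) (s := s) (l := l)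
    (v := l ^ 2 * V) hn hl0 (fun k hk => by simp_rw [e]; exact (hexp k hk).const_mul _) (fun k hk => by
      simp_rw [e]
      rw [integral_const_mul]
      -- Uses `exp u ≤ 1 + u + u ^ 2` for `|u| ≤ 1`, so only the second moment of `g` enters.
      have h1 : ∫ x, Real.exp (k * g x) ∂μ ≤ ∫ x, (1 + k * g x + k ^ 2 * g x ^ 2) ∂μ := by
        refine integral_mono_ae (hexp k hk)
          (((integrable_const _).add (hgi.const_mul k)).add (hg2.const_mul _)) ?_
        filter_upwards [hsmall k hk] with x hx
        have := (abs_le.1 (Real.abs_exp_sub_one_sub_id_le hx)).2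
        have e2 : (k * g x) ^ 2 = k ^ 2 * g x ^ 2 := by ring
        show Real.exp (k * g x) ≤ 1 + k * g x + k ^ 2 * g x ^ 2
        linarith
      have h2 : ∫ x, (1 + k * g x + k ^ 2 * g x ^ 2) ∂μ = 1 + k * m + k ^ 2 * ∫ x, g x ^ 2 ∂μ := by
        rw [integral_add (f := fun x => 1 + k * g x) ((integrable_const _).add (hgi.const_mul k))
          (hg2.const_mul _), integral_add (integrable_const _) (hgi.const_mul k),
          integral_const_mul, integral_const_mul]
        simp [hm]
      have h3 : k ^ 2 = l ^ 2 := by rw [← hk, sq_abs]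
      have h4 : ∫ x, Real.exp (k * g x) ∂μ ≤ Real.exp (k * m + l ^ 2 * V) := by
        refine (h1.trans (le_of_eq h2)).trans ?_
        have := Real.add_one_le_exp (k * m + l ^ 2 * V)
        have h5 := mul_le_mul_of_nonneg_left hv (sq_nonneg l)
        rw [h3]
        linarith
      refine (mul_le_mul_of_nonneg_left h4 (Real.exp_pos _).le).trans (le_of_eq ?_)
      rw [← Real.exp_add]; congr 1; ring)
  refine h.trans (le_of_eq ?_)
  congr 4
  rw [hl]
  field_simp
  ring

end Concentration

/-! ## The ellipsoid argument -/

section Ellipsoid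

open Matrix

variable {ι : Type*} [Fintype ι]

/-- Cauchy–Schwarz for the inner product of a positive definite matrix. -/
theorem Matrix.PosDef.dotProduct_sq_le [DecidableEq ι] {S : Matrix ι ι ℝ} (hS : S.PosDef)
    (p x : ι → ℝ) :
    (p ⬝ᵥ x) ^ 2 ≤ (p ⬝ᵥ (S⁻¹ *ᵥ p)) * (x ⬝ᵥ (S *ᵥ x)) := by
  set y := S⁻¹ *ᵥ p with hy
  have hu : IsUnit S.det := hS.det_pos.ne'.isUnit
  have hSy : S *ᵥ y = p := by rw [hy, mulVec_mulVec, mul_nonsing_inv _ hu, one_mulVec]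
  have hsymm : y ⬝ᵥ (S *ᵥ x) = p ⬝ᵥ x := by
    have hT : Sᵀ = S := by simpa [conjTranspose_eq_transpose_of_trivial] using hS.isHermitian.eq
    rw [dotProduct_mulVec, ← mulVec_transpose, hT, hSy]
  have hpos : ∀ z : ι → ℝ, 0 ≤ z ⬝ᵥ (S *ᵥ z) := fun z => by
    simpa using hS.posSemidef.dotProduct_mulVec_nonneg z
  -- The quadratic form of `S` at `c • y - x`, expanded in `c`; the claim is that its discriminant
  -- is nonpositive.
  have hq : ∀ c : ℝ, 0 ≤ (p ⬝ᵥ y) * (c * c) + (-2 * (p ⬝ᵥ x)) * c + x ⬝ᵥ (S *ᵥ x) := by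
    intro c
    have := hpos (c • y - x)
    rw [mulVec_sub, mulVec_smul, hSy, sub_dotProduct, dotProduct_sub, dotProduct_sub,
      smul_dotProduct, smul_dotProduct, dotProduct_smul, dotProduct_smul, hsymm,
      dotProduct_comm y p, dotProduct_comm x p] at this
    simp only [smul_eq_mul] at this
    linarith
  have := discrim_le_zero hq
  rw [discrim] at this
  nlinarith

/-- The matrix determinant lemma for a positive definite matrix. -/
theorem Matrix.PosDef.det_add_smul_vecMulVec [DecidableEq ι] {S : Matrix ι ι ℝ} (hS : S.PosDef)
    (p : ι → ℝ) (c : ℝ) :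
    (S + c • vecMulVec p p).det = S.det * (1 + c * (p ⬝ᵥ (S⁻¹ *ᵥ p))) := by
  have hu : IsUnit S.det := hS.det_pos.ne'.isUnit
  have h := det_add_replicateCol_mul_replicateRow (ι := Unit) hu (c • p) p
  have e : replicateCol Unit (c • p) * replicateRow Unit p = c • vecMulVec p p := by
    rw [← vecMulVec_eq, smul_vecMulVec]
  rw [e] at h
  rw [h]
  congr 1
  rw [det_unique]
  simp only [add_apply, one_apply_eq, Matrix.mul_assoc]
  congr 1
  simp only [mul_apply, replicateRow_apply, replicateCol_apply, dotProduct, mulVec, Pi.smul_apply,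
    smul_eq_mul, Finset.mul_sum]
  refine Finset.sum_congr rfl fun i _ => Finset.sum_congr rfl fun j _ => by ring

/-- A positive definite matrix of trace at most `c * card` has determinant at most `c ^ card`. -/
theorem Matrix.PosDef.det_le_pow_of_trace_le [DecidableEq ι] [Nonempty ι] {S : Matrix ι ι ℝ}
    (hS : S.PosDef) {c : ℝ} (hc : S.trace ≤ c * Fintype.card ι) :
    S.det ≤ c ^ Fintype.card ι := by
  have h1 : S.det = ∏ i, hS.isHermitian.eigenvalues i := by
    simpa using hS.isHermitian.det_eq_prod_eigenvalues
  have h2 : S.trace = ∑ i, hS.isHermitian.eigenvalues i := by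
    simpa using hS.isHermitian.trace_eq_sum_eigenvalues
  have hn : (0 : ℝ) < Fintype.card ι := by exact_mod_cast Fintype.card_pos
  have hnn : ∀ i, 0 ≤ hS.isHermitian.eigenvalues i := fun i => (hS.eigenvalues_pos i).le
  -- AM-GM for the eigenvalues, with equal weights.
  have amgm := Real.geom_mean_le_arith_mean_weighted Finset.univ
    (fun _ : ι => 1 / (Fintype.card ι : ℝ)) hS.isHermitian.eigenvalues
    (fun _ _ => by positivity) (by simp) (fun i _ => hnn i)
  rw [← Finset.mul_sum, ← h2] at amgm
  have h3 : ∏ i, hS.isHermitian.eigenvalues i ^ (1 / (Fintype.card ι : ℝ)) ≤ c := by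
    refine amgm.trans ?_
    rw [one_div, inv_mul_le_iff₀ hn]
    linarith
  have h4 := pow_le_pow_left₀ (Finset.prod_nonneg fun i _ => Real.rpow_nonneg (hnn i) _) h3
    (Fintype.card ι)
  rw [← Finset.prod_pow] at h4
  rw [h1]
  refine (le_of_eq ?_).trans h4
  refine Finset.prod_congr rfl fun i _ => ?_
  rw [← Real.rpow_natCast, ← Real.rpow_mul (hnn i), one_div, inv_mul_cancel₀ hn.ne', Real.rpow_one]

/-- Since `(1 + 1/M)^M ≤ e`, the power is at least `1/e`, and `e ^ 2 < 10`. In the ellipsoid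
argument the power is the determinant lost by rescaling and `10` the factor gained from the new
direction. -/
theorem exp_one_le_pow_mul_ten {M : ℕ} (hM : 1 ≤ M) :
    Real.exp 1 ≤ ((M : ℝ) / (M + 1)) ^ M * 10 := by
  have hM' : (0 : ℝ) < M := by exact_mod_cast hM
  have h1 : (1 + 1 / (M : ℝ)) ^ M ≤ Real.exp 1 := by
    have := pow_le_pow_left₀ (by positivity) (Real.add_one_le_exp (1 / (M : ℝ))) M
    rw [← Real.exp_nat_mul] at this
    rw [mul_one_div_cancel hM'.ne'] at this
    linarith [add_comm (1 / (M : ℝ)) 1 ▸ this]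
  have h2 : ((M : ℝ) / (M + 1)) ^ M * (1 + 1 / (M : ℝ)) ^ M = 1 := by
    rw [← mul_pow]
    have : (M : ℝ) / (M + 1) * (1 + 1 / M) = 1 := by field_simp
    rw [this, one_pow]
  have h3 := Real.exp_one_lt_d9
  have h0 : 0 < ((M : ℝ) / (M + 1)) ^ M := by positivity
  have h4 : 1 ≤ ((M : ℝ) / (M + 1)) ^ M * Real.exp 1 :=
    h2.symm.le.trans (mul_le_mul_of_nonneg_left h1 h0.le)
  have h5 := Real.exp_pos 1
  nlinarith

/-- Vectors `x t` on which all earlier functionals `p s` are at most `β`, while `p t` is at least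
`3 √M β`, form a short sequence. -/
theorem card_le_of_dotProduct_gap [DecidableEq ι] [Nonempty ι] {n : ℕ} {p x : ℕ → ι → ℝ}
    {β P B : ℝ} (hβ : 0 < β) (hB : 0 < B) (hP : 0 ≤ P)
    (hp : ∀ t < n, p t ⬝ᵥ p t ≤ P ^ 2) (hx : ∀ t < n, x t ⬝ᵥ x t ≤ B ^ 2) (hPB : β ≤ P * B)
    (hlo : ∀ t < n, ∀ s < t, |p s ⬝ᵥ x t| ≤ β)
    (hhi : ∀ t < n, 3 * √(Fintype.card ι : ℝ) * β ≤ p t ⬝ᵥ x t) :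
    (n : ℝ) ≤ 2 * Fintype.card ι * Real.log (P * B / β) := by
  set M := Fintype.card ι with hMdef
  have hM1 : 1 ≤ M := Fintype.card_pos
  have hM : (0 : ℝ) < M := by exact_mod_cast hM1
  -- The ellipsoid of `y` with `y ⬝ᵥ S t *ᵥ y ≤ 1` starts as the ball of radius `B`. Each step
  -- averages in the slab `|p t ⬝ᵥ y| ≤ β`, with weights `M/(M+1)` and `1/(M+1)`, so it still
  -- contains the intersection of the ball with all slabs so far.
  let S : ℕ → Matrix ι ι ℝ := fun t => Nat.rec ((1 / B ^ 2) • (1 : Matrix ι ι ℝ))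
    (fun t S => ((M : ℝ) / (M + 1)) • (S + (1 / (M * β ^ 2)) • vecMulVec (p t) (p t))) t
  have hS0 : S 0 = (1 / B ^ 2) • (1 : Matrix ι ι ℝ) := rfl
  have hSs : ∀ t, S (t + 1) =
      ((M : ℝ) / (M + 1)) • (S t + (1 / (M * β ^ 2)) • vecMulVec (p t) (p t)) := fun t => rfl
  have hvv : ∀ v : ι → ℝ, (vecMulVec v v).PosSemidef := fun v => by
    simpa using posSemidef_vecMulVec_self_star v
  have hpd : ∀ t, (S t).PosDef := by
    intro t
    induction t with
    | zero => rw [hS0]; exact PosDef.one.smul (by positivity)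
    | succ t ih =>
      rw [hSs]
      exact (ih.add_posSemidef ((hvv _).smul (by positivity))).smul (by positivity)
  have hquad : ∀ (t : ℕ) (y : ι → ℝ), y ⬝ᵥ (S (t + 1) *ᵥ y) =
      (M : ℝ) / (M + 1) * (y ⬝ᵥ (S t *ᵥ y) + 1 / (M * β ^ 2) * (p t ⬝ᵥ y) ^ 2) := by
    intro t y
    rw [hSs, smul_mulVec, dotProduct_smul, add_mulVec, dotProduct_add, smul_mulVec,
      dotProduct_smul, vecMulVec_mulVec, IsCentralScalar.op_smul_eq_smul, dotProduct_smul,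
      dotProduct_comm y (p t)]
    simp only [smul_eq_mul]
    ring
  have hin : ∀ t ≤ n, ∀ y : ι → ℝ, y ⬝ᵥ y ≤ B ^ 2 → (∀ s < t, |p s ⬝ᵥ y| ≤ β) →
      y ⬝ᵥ (S t *ᵥ y) ≤ 1 := by
    intro t
    induction t with
    | zero =>
      intro _ y hy _
      rw [hS0, smul_mulVec, one_mulVec, dotProduct_smul, smul_eq_mul, one_div_mul_eq_div]
      exact div_le_one_of_le₀ hy (by positivity)
    | succ t ih =>
      intro ht y hy hs
      rw [hquad]
      have h1 := ih (by omega) y hy fun s hst => hs s (by omega)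
      have h2 : (p t ⬝ᵥ y) ^ 2 ≤ β ^ 2 := sq_le_sq' (abs_le.1 (hs t (by omega))).1
        (abs_le.1 (hs t (by omega))).2
      have h3 : 1 / (M * β ^ 2) * (p t ⬝ᵥ y) ^ 2 ≤ 1 / M := by
        refine (mul_le_mul_of_nonneg_left h2 (by positivity)).trans (le_of_eq ?_)
        field_simp
      rw [div_mul_eq_mul_div, div_le_one (by positivity)]
      have h4 : (M : ℝ) * (1 + 1 / M) = M + 1 := by field_simp
      rw [← h4]
      gcongr
  -- Since `x t` lies in the current ellipsoid and `p t ⬝ᵥ x t` is at least `3 √M β`, Cauchy–Schwarz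
  -- makes `p t` long in the dual norm. The determinant lemma then gives a factor `1 + 9 = 10`
  -- before rescaling, and at least `e` after it.
  have hdet : ∀ t ≤ n, (1 / B ^ 2) ^ M * Real.exp 1 ^ t ≤ (S t).det := by
    intro t
    induction t with
    | zero =>
      intro _
      rw [hS0, det_smul, det_one, pow_zero]
    | succ t ih =>
      intro ht
      have h1 := ih (by omega)
      have h2 := hin t (by omega) (x t) (hx t (by omega)) (hlo t (by omega))
      have h3 := (hpd t).dotProduct_sq_le (p t) (x t)
      have h4 := hhi t (by omega)
      have hq0 : 0 ≤ p t ⬝ᵥ ((S t)⁻¹ *ᵥ p t) := by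
        simpa using (hpd t).inv.posSemidef.dotProduct_mulVec_nonneg (p t)
      have h5 : 9 * M * β ^ 2 ≤ p t ⬝ᵥ ((S t)⁻¹ *ᵥ p t) := by
        have : (3 * √(M : ℝ) * β) ^ 2 ≤ (p t ⬝ᵥ x t) ^ 2 :=
          pow_le_pow_left₀ (by positivity) h4 2
        rw [mul_pow, mul_pow, Real.sq_sqrt hM.le] at this
        nlinarith [mul_le_mul_of_nonneg_left h2 hq0]
      rw [hSs, det_smul, (hpd t).det_add_smul_vecMulVec, ← hMdef, pow_succ]
      have h6 : 10 ≤ 1 + 1 / (M * β ^ 2) * (p t ⬝ᵥ ((S t)⁻¹ *ᵥ p t)) := by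
        have := mul_le_mul_of_nonneg_left h5 (show 0 ≤ 1 / (M * β ^ 2) by positivity)
        have e : 1 / (M * β ^ 2) * (9 * M * β ^ 2) = 9 := by field_simp
        linarith
      have hd := (hpd t).det_pos
      calc (1 / B ^ 2) ^ M * (Real.exp 1 ^ t * Real.exp 1)
          = ((1 / B ^ 2) ^ M * Real.exp 1 ^ t) * Real.exp 1 := by ring
        _ ≤ (S t).det * (((M : ℝ) / (M + 1)) ^ M * 10) :=
            mul_le_mul h1 (exp_one_le_pow_mul_ten hM1) (Real.exp_pos _).le hd.le
        _ = ((M : ℝ) / (M + 1)) ^ M * ((S t).det * 10) := by ring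
        _ ≤ _ := by gcongr
  -- The trace does not keep pace with the determinant: the rescaling absorbs each update because `M
  -- ^ 2 + 1 ≤ M * (M + 1)`. The base case is where `β ≤ P * B` is used.
  have htr : ∀ t ≤ n, (S t).trace ≤ (P / β) ^ 2 * M := by
    have hratio : (1 / B) ≤ P / β := by
      rw [div_le_div_iff₀ hB hβ]; linarith
    intro t
    induction t with
    | zero =>
      intro _
      rw [hS0, trace_smul, trace_one, smul_eq_mul, ← _root_.one_div_pow]
      gcongr
    | succ t ih =>
      intro ht
      have h1 := ih (by omega)
      have h2 := hp t (by omega)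
      rw [hSs, trace_smul, trace_add, trace_smul, trace_vecMulVec, smul_eq_mul, smul_eq_mul]
      have h3 : 1 / (M * β ^ 2) * (p t ⬝ᵥ p t) ≤ (P / β) ^ 2 * (1 / M) := by
        refine (mul_le_mul_of_nonneg_left h2 (by positivity)).trans (le_of_eq ?_)
        field_simp
      rw [div_mul_eq_mul_div, div_le_iff₀ (by positivity)]
      have hM1' : (1 : ℝ) ≤ M := by exact_mod_cast hM1
      have h4 : (M : ℝ) * ((P / β) ^ 2 * M + (P / β) ^ 2 * (1 / M)) =
          (P / β) ^ 2 * (M ^ 2 + 1) := by field_simp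
      have h5 := mul_le_mul_of_nonneg_left (add_le_add h1 h3) hM.le
      rw [h4] at h5
      refine h5.trans ?_
      rw [mul_assoc]
      gcongr
      nlinarith
  have hfin : (1 / B ^ 2) ^ M * Real.exp 1 ^ n ≤ ((P / β) ^ 2) ^ M :=
    (hdet n le_rfl).trans ((hpd n).det_le_pow_of_trace_le (htr n le_rfl))
  have hP0 : 0 < P := by
    rcases hP.lt_or_eq with h | h
    · exact h
    · rw [← h] at hPB; linarith
  have h7 : Real.exp 1 ^ n ≤ ((P * B / β) ^ 2) ^ M := by
    have e : ((P * B / β) ^ 2) ^ M = (B ^ 2) ^ M * ((P / β) ^ 2) ^ M := by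
      rw [← mul_pow, ← mul_pow]; congr 2; ring
    have e2 : (B ^ 2) ^ M * (1 / B ^ 2) ^ M = 1 := by
      rw [← mul_pow, mul_one_div_cancel (by positivity), one_pow]
    rw [e]
    calc Real.exp 1 ^ n = (B ^ 2) ^ M * ((1 / B ^ 2) ^ M * Real.exp 1 ^ n) := by
          rw [← mul_assoc, e2, one_mul]
      _ ≤ _ := by gcongr
  have h8 := Real.log_le_log (by positivity) h7
  rw [Real.log_pow, Real.log_exp, Real.log_pow, Real.log_pow] at h8
  push_cast at h8
  linarith

end Ellipsoid

noncomputable section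

/-! ## Laws of histories -/

section HistLaw

variable {X : Type u} {A : Type v} [MeasurableSpace X] [MeasurableSpace A]

theorem measurable_finSnoc {β γ : Type*} [MeasurableSpace β] [MeasurableSpace γ] {n : ℕ}
    {f : γ → Fin n → β} {g : γ → β} (hf : Measurable f) (hg : Measurable g) :
    Measurable fun z => Fin.snoc (α := fun _ => β) (f z) (g z) := by
  refine measurable_pi_lambda _ fun i => ?_
  refine Fin.lastCases ?_ (fun j => ?_) i
  · simpa using hg
  · simp only [Fin.snoc_castSucc]; fun_prop

/-- The history one level later. -/
def Hist.extend {X : Type u} {A : Type v} {h : ℕ} (z : Hist X A h × A × ℝ × X) :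
    Hist X A (h + 1) :=
  (Fin.snoc (α := fun _ => X × A × ℝ) z.1.1 (z.1.2, z.2.1, z.2.2.1), z.2.2.2)

theorem Hist.measurable_extend {h : ℕ} : Measurable (Hist.extend (X := X) (A := A) (h := h)) := by
  unfold Hist.extend
  exact (measurable_finSnoc (by fun_prop) (by fun_prop)).prodMk (by fun_prop)

/-- The part of a history up to level `n`. -/
def Hist.cut {X : Type u} {A : Type v} {m : ℕ} (n : ℕ) (hn : n ≤ m) (τ : Hist X A m) :
    Hist X A n :=
  (fun i => τ.1 (Fin.castLE hn i), if h : n < m then (τ.1 ⟨n, h⟩).1 else τ.2)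

theorem Hist.measurable_cut {m n : ℕ} (hn : n ≤ m) :
    Measurable (Hist.cut (X := X) (A := A) n hn) := by
  refine Measurable.prodMk (by fun_prop) ?_
  by_cases h : n < m
  · simp only [h, dif_pos]; fun_prop
  · simp only [h, dif_neg, not_false_eq_true]; fun_prop

theorem Hist.cut_self {X : Type u} {A : Type v} {m : ℕ} (τ : Hist X A m) :
    Hist.cut m le_rfl τ = τ := by
  ext <;> simp [Hist.cut]

theorem Hist.cut_extend {X : Type u} {A : Type v} {m n : ℕ} (hn : n ≤ m)
    (z : Hist X A m × A × ℝ × X) :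
    Hist.cut n (Nat.le_succ_of_le hn) (Hist.extend z) = Hist.cut n hn z.1 := by
  have h1 : n < m + 1 := by omega
  refine Prod.ext (funext fun i => ?_) ?_
  · have : Fin.castLE (Nat.le_succ_of_le hn) i = (Fin.castLE hn i).castSucc := rfl
    simp only [Hist.cut, Hist.extend, this, Fin.snoc_castSucc]
  · simp only [Hist.cut, Hist.extend, h1, dif_pos]
    by_cases h : n < m
    · have : (⟨n, h1⟩ : Fin (m + 1)) = (⟨n, h⟩ : Fin m).castSucc := rfl
      simp only [h, this, Fin.snoc_castSucc, dif_pos]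
    · obtain rfl : n = m := by omega
      have : (⟨n, h1⟩ : Fin (n + 1)) = Fin.last n := rfl
      simp only [this, Fin.snoc_last, lt_irrefl, dif_neg, not_false_eq_true]

namespace CDP

variable (C : CDP X A)

theorem histLaw_succ (σ : Behavior X A) (h : ℕ) :
    C.histLaw σ (h + 1) = (C.histLaw σ h ⊗ₘ (σ h ⊗ₖ C.step h)).map Hist.extend := rfl

instance (h : ℕ) : IsMarkovKernel (C.step h) := C.step_markov h

instance isProbabilityMeasure_histLaw (σ : Behavior X A) [∀ h, IsMarkovKernel (σ h)] (h : ℕ) :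
    IsProbabilityMeasure (C.histLaw σ h) := by
  induction h with
  | zero =>
    have := C.init_prob
    exact Measure.isProbabilityMeasure_map (by fun_prop)
  | succ h ih =>
    rw [histLaw_succ]
    exact Measure.isProbabilityMeasure_map Hist.measurable_extend.aemeasurable

instance (σ : Behavior X A) [∀ h, IsMarkovKernel (σ h)] : IsProbabilityMeasure (C.trajLaw σ) :=
  C.isProbabilityMeasure_histLaw σ _

/-- Each further level appends a Markov kernel, which leaves the marginal of the past unchanged.
This moves expectations of quantities determined by the first levels from whole trajectories to
short histories. -/
theorem map_cut_histLaw (σ : Behavior X A) [∀ h, IsMarkovKernel (σ h)] {n m : ℕ} (hn : n ≤ m) :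
    (C.histLaw σ m).map (Hist.cut n hn) = C.histLaw σ n := by
  induction m, hn using Nat.le_induction with
  | base =>
    have : Hist.cut (X := X) (A := A) n le_rfl = id := funext fun τ => Hist.cut_self τ
    rw [this, Measure.map_id]
  | succ m hn ih =>
    rw [histLaw_succ, Measure.map_map (Hist.measurable_cut _) Hist.measurable_extend]
    have : Hist.cut (X := X) (A := A) n (Nat.le_succ_of_le hn) ∘ Hist.extend =
        Hist.cut n hn ∘ Prod.fst := funext fun z => Hist.cut_extend hn z
    rw [this, ← Measure.map_map (Hist.measurable_cut _) measurable_fst]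
    have h2 := Measure.fst_compProd (C.histLaw σ m) (σ m ⊗ₖ C.step m)
    rw [Measure.fst] at h2
    rw [h2, ih]

theorem lintegral_histLaw_succ (σ : Behavior X A) [∀ h, IsMarkovKernel (σ h)] (h : ℕ)
    {g : Hist X A (h + 1) → ℝ≥0∞} (hg : Measurable g) :
    ∫⁻ τ, g τ ∂C.histLaw σ (h + 1) = ∫⁻ s, ∫⁻ a, ∫⁻ y, g (Hist.extend (s, a, y))
      ∂C.step h (s, a) ∂σ h s ∂C.histLaw σ h := by
  rw [histLaw_succ, lintegral_map hg Hist.measurable_extend,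
    Measure.lintegral_compProd (f := fun z => g (Hist.extend z)) (hg.comp Hist.measurable_extend)]
  refine lintegral_congr fun s => ?_
  exact Kernel.lintegral_compProd _ _ _
    ((hg.comp Hist.measurable_extend).comp measurable_prodMk_left)

theorem histLaw_congr {σ σ' : Behavior X A} {n : ℕ} (h : ∀ l < n, σ l = σ' l) :
    C.histLaw σ n = C.histLaw σ' n := by
  induction n with
  | zero => rfl
  | succ n ih => rw [histLaw_succ, histLaw_succ, ih fun l hl => h l (by omega), h n (by omega)]

variable [MeasurableSingletonClass A] [Countable A]

/-- Where a behavior follows `π`, the actions are those of `π`. -/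
theorem ae_action_eq (σ : Behavior X A) [∀ h, IsMarkovKernel (σ h)] (π : Policy X A) {l m : ℕ}
    (hl : l < m) (hσ : σ l = actKernel π l) :
    ∀ᵐ τ ∂C.histLaw σ m, (τ.1 ⟨l, hl⟩).2.1 = π.1 (τ.1 ⟨l, hl⟩).1 := by
  have hπ := π.2
  have hms : MeasurableSet {p : X × A × ℝ | p.2.1 = π.1 p.1} :=
    measurableSet_eq_fun (by fun_prop) (by fun_prop)
  have h1 : ∀ᵐ τ ∂C.histLaw σ (l + 1), (τ.1 (Fin.last l)) ∈ {p : X × A × ℝ | p.2.1 = π.1 p.1} := by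
    have hms' : MeasurableSet {τ : Hist X A (l + 1) |
        ¬ τ.1 (Fin.last l) ∈ {p : X × A × ℝ | p.2.1 = π.1 p.1}} :=
      (hms.preimage (by fun_prop : Measurable fun τ : Hist X A (l + 1) => τ.1 (Fin.last l))).compl
    rw [ae_iff, ← lintegral_indicator_one hms',
      C.lintegral_histLaw_succ σ l (measurable_one.indicator hms'), hσ]
    refine (lintegral_congr fun s => ?_).trans lintegral_zero
    rw [actKernel, Kernel.lintegral_deterministic]
    refine (lintegral_congr fun y => ?_).trans lintegral_zero
    simp [Set.indicator, Hist.extend]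
  rw [← C.map_cut_histLaw σ (Nat.succ_le_of_lt hl)] at h1
  exact ae_of_ae_map (Hist.measurable_cut _).aemeasurable h1

end CDP

end HistLaw

end

noncomputable section

/-! ## Bellman errors -/

section BellmanError

variable {X : Type u} {A : Type v} {F : Type w} [MeasurableSpace X] [MeasurableSpace A]

instance (π : Policy X A) (h : ℕ) : IsMarkovKernel (actKernel π h) :=
  Kernel.isMarkovKernel_deterministic _

instance (π : Policy X A) (h : ℕ) : IsMarkovKernel (follow π h) :=
  inferInstanceAs (IsMarkovKernel (actKernel π h))

instance (π π₂ : Policy X A) (h l : ℕ) : IsMarkovKernel (rollIn π π₂ h l) := by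
  unfold rollIn; split_ifs <;> infer_instance

instance [Fintype A] [Nonempty A] (π : Policy X A) (h l : ℕ) :
    IsMarkovKernel (explore π h l) := by
  unfold explore; split_ifs <;> infer_instance

theorem rollIn_self (π : Policy X A) (h : ℕ) : rollIn π π h = follow π := by
  funext l; simp [rollIn, follow]

namespace CDP

variable {C : CDP X A} (Q : QClass X A F)

theorem measurable_q_comp {γ : Type*} [MeasurableSpace γ] (f : F) {x : γ → X} {a : γ → A}
    (hx : Measurable x) (ha : Measurable a) : Measurable fun z => Q.q f (x z) (a z) :=
  (Q.q_measurable f).comp (hx.prodMk ha)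

theorem measurable_residual (f : F) (h : Fin C.H) : Measurable (C.residual Q f h) := by
  unfold residual
  refine ((measurable_q_comp Q f (by fun_prop) (by fun_prop)).sub (by fun_prop)).sub ?_
  split_ifs
  · exact measurable_q_comp Q f (by fun_prop) (by fun_prop)
  · exact measurable_const

theorem ae_reward_mem (hC : C.BoundedRewards) (σ : Behavior X A) [∀ h, IsMarkovKernel (σ h)]
    (h : Fin C.H) : ∀ᵐ τ ∂C.trajLaw σ, (τ.1 h).2.2 ∈ Set.Icc (0 : ℝ) 1 := by
  filter_upwards [hC σ inferInstance] with τ hτ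
  exact ⟨hτ.1 h, (Finset.single_le_sum (fun i _ => hτ.1 i) (Finset.mem_univ h)).trans hτ.2⟩

theorem residual_mem {f : F} {h : Fin C.H} {τ : C.Traj} (hr : (τ.1 h).2.2 ∈ Set.Icc (0 : ℝ) 1) :
    C.residual Q f h τ ∈ Set.Icc (-2 : ℝ) 1 := by
  have h1 := Q.q_mem f (τ.1 h).1 (τ.1 h).2.1
  have h2 : (if hh : (h : ℕ) + 1 < C.H then
      Q.q f (τ.1 ⟨h + 1, hh⟩).1 (τ.1 ⟨h + 1, hh⟩).2.1 else 0) ∈ Set.Icc (0 : ℝ) 1 := by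
    split_ifs
    · exact Q.q_mem _ _ _
    · simp
  unfold residual
  constructor <;> linarith [h1.1, h1.2, h2.1, h2.2, hr.1, hr.2]

theorem ae_residual_mem (hC : C.BoundedRewards) (σ : Behavior X A) [∀ h, IsMarkovKernel (σ h)]
    (f : F) (h : Fin C.H) : ∀ᵐ τ ∂C.trajLaw σ, C.residual Q f h τ ∈ Set.Icc (-2 : ℝ) 1 := by
  filter_upwards [ae_reward_mem hC σ h] with τ hτ using residual_mem Q hτ

theorem sum_residual (f : F) (hH : 0 < C.H) (τ : C.Traj) :
    ∑ h, C.residual Q f h τ =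
      Q.q f (τ.1 ⟨0, hH⟩).1 (τ.1 ⟨0, hH⟩).2.1 - ∑ h, (τ.1 h).2.2 := by
  -- Extending by zero past the horizon turns the convention at the last level into an ordinary
  -- telescoping sum.
  let g : ℕ → ℝ := fun n => if hn : n < C.H then Q.q f (τ.1 ⟨n, hn⟩).1 (τ.1 ⟨n, hn⟩).2.1 else 0
  have h1 : ∀ h : Fin C.H, C.residual Q f h τ = (g h - g (h + 1)) - (τ.1 h).2.2 := by
    intro h
    simp only [residual, g, h.2, dif_pos]
    ring
  simp_rw [h1]
  rw [Finset.sum_sub_distrib, Fin.sum_univ_eq_sum_range (fun n => g n - g (n + 1)),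
    Finset.sum_range_sub']
  simp [g, hH]

variable (C) in
/-- The value that `f` predicts for its greedy policy. -/
def predValue (f : F) : ℝ := ∫ x, Q.q f x ((Q.greedy f).1 x) ∂C.init

theorem integrable_of_mem_Icc {Ω : Type*} [MeasurableSpace Ω] {μ : Measure Ω} [IsFiniteMeasure μ]
    {g : Ω → ℝ} (hg : Measurable g) {a b : ℝ} (h : ∀ᵐ x ∂μ, g x ∈ Set.Icc a b) :
    Integrable g μ := by
  refine Integrable.of_bound hg.aestronglyMeasurable (max |a| |b|) ?_
  filter_upwards [h] with x hx
  exact abs_le_max_abs_abs hx.1 hx.2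

variable (C) in
/-- The residual of `f` at level `h` when the next action is greedy, as a function of the history
up to the next context. -/
def greedyResidual (f : F) (h : Fin C.H) (s : Hist X A (h + 1)) : ℝ :=
  Q.q f (s.1 (Fin.last h)).1 (s.1 (Fin.last h)).2.1 - (s.1 (Fin.last h)).2.2 -
    if (h : ℕ) + 1 < C.H then Q.q f s.2 ((Q.greedy f).1 s.2) else 0

theorem measurable_greedyResidual (f : F) (h : Fin C.H) :
    Measurable (C.greedyResidual Q f h) := by
  have hπ := (Q.greedy f).2
  unfold greedyResidual
  refine ((measurable_q_comp Q f (by fun_prop) (by fun_prop)).sub (by fun_prop)).sub ?_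
  split_ifs
  · exact measurable_q_comp Q f (by fun_prop) (by fun_prop)
  · exact measurable_const

theorem abs_greedyResidual_le {f : F} {h : Fin C.H} {s : Hist X A (h + 1)}
    (hr : (s.1 (Fin.last h)).2.2 ∈ Set.Icc (0 : ℝ) 1) : |C.greedyResidual Q f h s| ≤ 2 := by
  have h1 := Q.q_mem f (s.1 (Fin.last h)).1 (s.1 (Fin.last h)).2.1
  have h2 : (if (h : ℕ) + 1 < C.H then Q.q f s.2 ((Q.greedy f).1 s.2) else 0) ∈
      Set.Icc (0 : ℝ) 1 := by
    split_ifs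
    · exact Q.q_mem _ _ _
    · simp
  unfold greedyResidual
  rw [abs_le]
  constructor <;> linarith [h1.1, h1.2, h2.1, h2.2, hr.1, hr.2]

theorem ae_last_reward_mem (hC : C.BoundedRewards) (σ : Behavior X A)
    [∀ h, IsMarkovKernel (σ h)] (h : Fin C.H) :
    ∀ᵐ s ∂C.histLaw σ (h + 1), (s.1 (Fin.last h)).2.2 ∈ Set.Icc (0 : ℝ) 1 := by
  have hms : MeasurableSet {s : Hist X A (h + 1) |
      (s.1 (Fin.last h)).2.2 ∈ Set.Icc (0 : ℝ) 1} :=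
    measurableSet_Icc.preimage (by fun_prop)
  rw [← C.map_cut_histLaw σ (Nat.succ_le_of_lt h.2),
    ae_map_iff (Hist.measurable_cut _).aemeasurable hms]
  exact ae_reward_mem hC σ h

section

variable [MeasurableSingletonClass A] [Countable A]

theorem integral_initial_q (f : F) (hH : 0 < C.H) :
    ∫ τ, Q.q f (τ.1 ⟨0, hH⟩).1 (τ.1 ⟨0, hH⟩).2.1 ∂C.trajLaw (follow (Q.greedy f)) =
      C.predValue Q f := by
  have hπ := (Q.greedy f).2
  have h1 : ∫ τ, Q.q f (τ.1 ⟨0, hH⟩).1 (τ.1 ⟨0, hH⟩).2.1 ∂C.trajLaw (follow (Q.greedy f)) =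
      ∫ τ, (fun s : Hist X A 0 => Q.q f s.2 ((Q.greedy f).1 s.2)) (Hist.cut 0 (Nat.zero_le _) τ)
        ∂C.trajLaw (follow (Q.greedy f)) := by
    refine integral_congr_ae ?_
    filter_upwards [C.ae_action_eq (follow (Q.greedy f)) (Q.greedy f) hH rfl] with τ hτ
    simp only [hτ, Hist.cut, hH, dif_pos]
  have hm : Measurable fun s : Hist X A 0 => Q.q f s.2 ((Q.greedy f).1 s.2) :=
    measurable_q_comp Q f (by fun_prop) (by fun_prop)
  rw [h1, trajLaw, ← integral_map (Hist.measurable_cut _).aemeasurable hm.aestronglyMeasurable,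
    C.map_cut_histLaw, histLaw, integral_map (by fun_prop) hm.aestronglyMeasurable, predValue]

/-- Bellman errors along the levels telescope. -/
theorem sum_bellmanError_greedy (hC : C.BoundedRewards) (hH : 0 < C.H) (f : F) :
    ∑ h, C.bellmanError Q f (Q.greedy f) h = C.predValue Q f - C.value (Q.greedy f) := by
  simp only [bellmanError, rollIn_self]
  rw [← integral_finsetSum _ fun h _ => integrable_of_mem_Icc (measurable_residual Q f h)
    (ae_residual_mem Q hC _ f h)]
  simp_rw [sum_residual Q f hH]
  rw [integral_sub, integral_initial_q, value]
  · exact integrable_of_mem_Icc (measurable_q_comp Q f (by fun_prop) (by fun_prop))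
      (Filter.Eventually.of_forall fun τ => Q.q_mem f _ _)
  · refine integrable_of_mem_Icc (by fun_prop) (a := 0) (b := 1) ?_
    filter_upwards [hC (follow (Q.greedy f)) inferInstance] with τ hτ
    exact ⟨Finset.sum_nonneg fun h _ => hτ.1 h, hτ.2⟩

/-- Under the roll-in the action after level `h` is almost surely greedy for `f`, so it can be
replaced by a function of the next context. The integrand then depends only on levels up to `h`,
where exploration and roll-in can be compared although they diverge later. -/
theorem bellmanError_eq (f : F) (π : Policy X A) (h : Fin C.H) :
    C.bellmanError Q f π h =
      ∫ s, C.greedyResidual Q f h s ∂C.histLaw (rollIn π (Q.greedy f) h) (h + 1) := by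
  rw [← C.map_cut_histLaw _ (Nat.succ_le_of_lt h.2),
    integral_map (Hist.measurable_cut _).aemeasurable
      (measurable_greedyResidual Q f h).aestronglyMeasurable, bellmanError]
  by_cases hh : (h : ℕ) + 1 < C.H
  · refine integral_congr_ae ?_
    filter_upwards [C.ae_action_eq (rollIn π (Q.greedy f) h) (Q.greedy f) hh
      (by simp [rollIn])] with τ hτ
    simp only [residual, greedyResidual, Hist.cut, hh, dif_pos, if_pos, hτ]
    rfl
  · refine integral_congr_ae (Filter.Eventually.of_forall fun τ => ?_)
    simp only [residual, greedyResidual, Hist.cut, hh, dif_neg, not_false_eq_true, if_neg]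
    rfl

end

/-! ### Importance weighting at the exploration level -/

section Explore

variable [Fintype A] [DecidableEq A]

/-- The importance weight at level `h`. -/
def importanceWeight (f : F) (h : ℕ) (s : Hist X A (h + 1)) : ℝ :=
  if (s.1 (Fin.last h)).2.1 = (Q.greedy f).1 (s.1 (Fin.last h)).1 then (Fintype.card A : ℝ) else 0

theorem importanceWeight_nonneg (f : F) (h : ℕ) (s : Hist X A (h + 1)) :
    0 ≤ importanceWeight Q f h s := by
  unfold importanceWeight; split_ifs <;> positivity

theorem importanceWeight_le (f : F) (h : ℕ) (s : Hist X A (h + 1)) :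
    importanceWeight Q f h s ≤ Fintype.card A := by
  unfold importanceWeight; split_ifs <;> simp

theorem weightedResidual_eq (f : F) (h : Fin C.H) (τ : C.Traj) :
    Oliver.weightedResidual Q f h τ =
      importanceWeight Q f h (Hist.cut (h + 1) (Nat.succ_le_of_lt h.2) τ) *
        C.greedyResidual Q f h (Hist.cut (h + 1) (Nat.succ_le_of_lt h.2) τ) := by
  have e : Fin.castLE (Nat.succ_le_of_lt h.2) (Fin.last (h : ℕ)) = h := rfl
  unfold Oliver.weightedResidual importanceWeight greedyResidual
  congr 1
  · simp only [Hist.cut, e]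
    split_ifs <;> simp
  · simp only [Hist.cut, e]
    by_cases hh : (h : ℕ) + 1 < C.H
    · simp [hh]
    · simp [hh]

theorem ae_abs_weightedResidual_le [Nonempty A] (hC : C.BoundedRewards) (f : F) (π : Policy X A)
    (h : Fin C.H) : ∀ᵐ τ ∂C.trajLaw (explore π h),
      |Oliver.weightedResidual Q f h τ| ≤ 2 * Fintype.card A := by
  filter_upwards [ae_reward_mem hC (explore π h) h] with τ hτ
  rw [weightedResidual_eq, abs_mul, abs_of_nonneg (importanceWeight_nonneg _ _ _ _), mul_comm]
  exact mul_le_mul (abs_greedyResidual_le Q hτ) (importanceWeight_le _ _ _ _)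
    (importanceWeight_nonneg _ _ _ _) zero_le_two

variable [MeasurableSingletonClass A]

theorem measurable_importanceWeight (f : F) (h : ℕ) :
    Measurable (importanceWeight Q f h) := by
  have hπ := (Q.greedy f).2
  exact Measurable.ite (measurableSet_eq_fun (by fun_prop) (by fun_prop)) measurable_const
    measurable_const

theorem measurable_weightedResidual (f : F) (h : Fin C.H) :
    Measurable (Oliver.weightedResidual (C := C) Q f h) := by
  simp_rw [funext (weightedResidual_eq (C := C) Q f h)]
  exact ((measurable_importanceWeight Q f h).comp (Hist.measurable_cut _)).mul
    ((measurable_greedyResidual Q f h).comp (Hist.measurable_cut _))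

variable [Nonempty A]

/-- Importance weighting changes the uniform action into the greedy one. -/
theorem withDensity_importanceWeight (f : F) (π : Policy X A) (h : ℕ) :
    (C.histLaw (explore π h) (h + 1)).withDensity
        (fun s => ENNReal.ofReal (importanceWeight Q f h s)) =
      C.histLaw (rollIn π (Q.greedy f) h) (h + 1) := by
  have hw := (measurable_importanceWeight Q f h).ennreal_ofReal
  have hπ := (Q.greedy f).2
  refine Measure.ext_of_lintegral _ fun g hg => ?_
  rw [lintegral_withDensity_eq_lintegral_mul _ hw hg, C.lintegral_histLaw_succ _ _ (hw.mul hg),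
    C.lintegral_histLaw_succ _ _ hg]
  -- The two behaviors agree before level `h`. At level `h` only the greedy action has nonzero
  -- weight, and its weight `K` cancels the uniform probability `1/K`.
  have hl : C.histLaw (explore π h) h = C.histLaw (rollIn π (Q.greedy f) h) h :=
    C.histLaw_congr fun l hl => by simp [explore, rollIn, hl, hl.ne]
  rw [hl]
  refine lintegral_congr fun s => ?_
  have h1 : rollIn π (Q.greedy f) h h = actKernel (Q.greedy f) h := by simp [rollIn]
  have h2 : explore π h h = Kernel.const _ (PMF.uniformOfFintype A).toMeasure := by simp [explore]
  rw [h1, h2, actKernel, Kernel.lintegral_deterministic, Kernel.const_apply, lintegral_fintype]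
  rw [Finset.sum_eq_single ((Q.greedy f).1 s.2)]
  · rw [PMF.toMeasure_apply_singleton _ _ (measurableSet_singleton _), ← lintegral_mul_const _ ?_]
    · refine lintegral_congr fun y => ?_
      have : ENNReal.ofReal (Fintype.card A : ℝ) * (Fintype.card A : ℝ≥0∞)⁻¹ = 1 := by
        rw [ENNReal.ofReal_natCast]
        exact ENNReal.mul_inv_cancel (by simp) (by simp)
      simp only [Pi.mul_apply, importanceWeight, Hist.extend, Fin.snoc_last, if_pos,
        PMF.uniformOfFintype_apply]
      rw [mul_right_comm, this, one_mul]
    · exact (hw.mul hg).comp (Hist.measurable_extend.comp (by fun_prop))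
  · intro a _ ha
    have : ∀ y : ℝ × X, importanceWeight Q f h (Hist.extend (s, a, y)) = 0 := by
      intro y
      simp only [importanceWeight, Hist.extend, Fin.snoc_last, if_neg ha]
    simp [this]
  · simp

theorem integral_importanceWeight_mul (f : F) (π : Policy X A) (h : ℕ)
    (g : Hist X A (h + 1) → ℝ) :
    ∫ s, importanceWeight Q f h s * g s ∂C.histLaw (explore π h) (h + 1) =
      ∫ s, g s ∂C.histLaw (rollIn π (Q.greedy f) h) (h + 1) := by
  rw [← withDensity_importanceWeight, integral_withDensity_eq_integral_toReal_smul
    (measurable_importanceWeight Q f h).ennreal_ofReal (by simp)]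
  refine integral_congr_ae (Filter.Eventually.of_forall fun s => ?_)
  simp only [ENNReal.toReal_ofReal (importanceWeight_nonneg Q f h s), smul_eq_mul]

/-- The importance-weighted residual is unbiased. -/
theorem integral_weightedResidual (f : F) (π : Policy X A) (h : Fin C.H) :
    ∫ τ, Oliver.weightedResidual Q f h τ ∂C.trajLaw (explore π h) = C.bellmanError Q f π h := by
  rw [bellmanError_eq, ← integral_importanceWeight_mul,
    ← C.map_cut_histLaw (explore π h) (Nat.succ_le_of_lt h.2),
    integral_map (f := fun s => importanceWeight Q f h s * C.greedyResidual Q f h s)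
      (Hist.measurable_cut _).aemeasurable
      ((measurable_importanceWeight Q f h).mul
        (measurable_greedyResidual Q f h)).aestronglyMeasurable]
  simp_rw [weightedResidual_eq]
  rfl

/-- One of the two weights in the square is spent on changing the measure to the greedy roll-in;
only the other is bounded by `K`. This yields order `K` instead of `K ^ 2`. -/
theorem integral_weightedResidual_sq_le (hC : C.BoundedRewards) (f : F) (π : Policy X A)
    (h : Fin C.H) : ∫ τ, Oliver.weightedResidual Q f h τ ^ 2 ∂C.trajLaw (explore π h) ≤
      4 * Fintype.card A := by
  have hm1 := measurable_importanceWeight Q f h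
  have hm2 := measurable_greedyResidual (C := C) Q f h
  have h1 : ∫ τ, Oliver.weightedResidual Q f h τ ^ 2 ∂C.trajLaw (explore π h) =
      ∫ s, importanceWeight Q f h s * (importanceWeight Q f h s * C.greedyResidual Q f h s ^ 2)
        ∂C.histLaw (explore π h) (h + 1) := by
    rw [← C.map_cut_histLaw (explore π h) (Nat.succ_le_of_lt h.2),
      integral_map (Hist.measurable_cut _).aemeasurable (by fun_prop)]
    refine integral_congr_ae (Filter.Eventually.of_forall fun τ => ?_)
    simp only [weightedResidual_eq]
    ring
  rw [h1, integral_importanceWeight_mul]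
  have h2 : ∀ᵐ s ∂C.histLaw (rollIn π (Q.greedy f) h) (h + 1),
      importanceWeight Q f h s * C.greedyResidual Q f h s ^ 2 ∈
        Set.Icc (0 : ℝ) (4 * Fintype.card A) := by
    filter_upwards [ae_last_reward_mem hC (rollIn π (Q.greedy f) h) h] with s hs
    have h3 := abs_le.1 (abs_greedyResidual_le Q (f := f) hs)
    have h4 := importanceWeight_nonneg Q f h s
    refine ⟨by positivity, ?_⟩
    rw [mul_comm]
    exact mul_le_mul (by nlinarith) (importanceWeight_le _ _ _ _) h4 (by norm_num)
  have h3 := integral_mono_ae (integrable_of_mem_Icc (by fun_prop) h2)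
    (integrable_const (4 * (Fintype.card A : ℝ))) (h2.mono fun s hs => hs.2)
  simpa using h3

end Explore

end CDP

end BellmanError

end

noncomputable section

/-! ## The law of a run -/

/-- A conditional union bound: on `B` the second stage is bounded by one, off `B` by `e₂`. As `B`
need not be measurable, its measurable hull is used in the integral. -/
theorem ProbabilityTheory.Kernel.compProd_apply_le_add {α β γ : Type*} [MeasurableSpace α]
    [MeasurableSpace β] [MeasurableSpace γ] (κ : Kernel α β) [IsMarkovKernel κ]
    (η : Kernel (α × β) γ) [IsMarkovKernel η] (a : α) {s : Set (β × γ)} (hs : MeasurableSet s)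
    {B : Set β} {e₁ e₂ : ℝ≥0∞} (hB : κ a B ≤ e₁)
    (h : ∀ b ∉ B, η (a, b) (Prod.mk b ⁻¹' s) ≤ e₂) : (κ ⊗ₖ η) a s ≤ e₁ + e₂ := by
  rw [Kernel.compProd_apply hs]
  calc ∫⁻ b, η (a, b) (Prod.mk b ⁻¹' s) ∂κ a
      ≤ ∫⁻ b, ((toMeasurable (κ a) B).indicator 1 b + e₂) ∂κ a := by
        refine lintegral_mono fun b => ?_
        by_cases hb : b ∈ B
        · simp only [Set.indicator_of_mem (subset_toMeasurable _ _ hb), Pi.one_apply]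
          exact prob_le_one.trans le_self_add
        · exact (h b hb).trans le_add_self
    _ ≤ e₁ + e₂ := by
        rw [lintegral_add_right _ measurable_const,
          lintegral_indicator_one (measurableSet_toMeasurable _ _), measure_toMeasurable]
        simpa using add_le_add_left hB e₂

theorem Measurable.of_countable_right {α β γ δ : Type*} [MeasurableSpace α] [MeasurableSpace β]
    [Countable β] [MeasurableSingletonClass β] [MeasurableSpace γ] [MeasurableSpace δ]
    {p : α → β → δ} (hp : ∀ b, Measurable fun a => p a b) {u : γ → α} {v : γ → β}
    (hu : Measurable u) (hv : Measurable v) : Measurable fun z => p (u z) (v z) :=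
  (measurable_from_prod_countable_left (f := fun z : α × β => p z.1 z.2) hp).comp (hu.prodMk hv)

set_option synthInstance.maxSize 1024

namespace Oliver

variable {X : Type u} {A : Type v} {F : Type w} [MeasurableSpace X] [MeasurableSpace A]
  {C : CDP X A} {Q : QClass X A F} {P : OliverParams}

theorem measurable_estValue (f : F) : Measurable (estValue Q (P := P) f) := by
  have hπ := (Q.greedy f).2
  refine (Finset.measurable_sum _ fun i _ => ?_).const_mul _
  exact CDP.measurable_q_comp Q f (by fun_prop) (by fun_prop)

theorem measurable_estOwnError (f : F) (h : Fin C.H) :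
    Measurable (estOwnError (C := C) Q (P := P) f h) :=
  (Finset.measurable_sum _ fun i _ =>
    (CDP.measurable_residual Q f h).comp (measurable_pi_apply i)).const_mul _

theorem measurable_estError [MeasurableSingletonClass A] [Fintype A] [DecidableEq A]
    (f : F) (h : Fin C.H) : Measurable (estError (C := C) Q (P := P) f h) :=
  (Finset.measurable_sum _ fun i _ =>
    (CDP.measurable_weightedResidual Q f h).comp (measurable_pi_apply i)).const_mul _

/-- What has been observed before iteration `t`. -/
def Transcript.upTo {T : ℕ} (r : Transcript (F := F) C P T) (t : Fin T) :
    Transcript (F := F) C P t :=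
  (r.1, fun s => r.2 (Fin.castLE t.2.le s))

/-- The transcript after one more iteration. -/
def Transcript.extend {T : ℕ} (z : Transcript (F := F) C P T × Iter (F := F) C P) :
    Transcript (F := F) C P (T + 1) :=
  (z.1.1, Fin.snoc (α := fun _ => Iter (F := F) C P) z.1.2 z.2)

theorem Transcript.measurable_upTo [MeasurableSpace F] {T : ℕ} (t : Fin T) :
    Measurable fun r : Transcript (F := F) C P T => r.upTo t := by
  unfold Transcript.upTo
  fun_prop

theorem Transcript.measurable_extend [MeasurableSpace F] {T : ℕ} :
    Measurable (Transcript.extend (F := F) (C := C) (P := P) (T := T)) := by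
  unfold Transcript.extend
  exact Measurable.prodMk (by fun_prop) (measurable_finSnoc (by fun_prop) (by fun_prop))

theorem Transcript.upTo_extend_castSucc {T : ℕ}
    (z : Transcript (F := F) C P T × Iter (F := F) C P) (t : Fin T) :
    (Transcript.extend z).upTo t.castSucc = z.1.upTo t := by
  refine Prod.ext rfl (funext fun s => ?_)
  have : Fin.castLE t.castSucc.2.le s = (Fin.castLE t.2.le s).castSucc := rfl
  simp only [upTo, extend, this, Fin.snoc_castSucc]

theorem Transcript.upTo_extend_last {T : ℕ}
    (z : Transcript (F := F) C P T × Iter (F := F) C P) :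
    (Transcript.extend z).upTo (Fin.last T) = z.1 := by
  refine Prod.ext rfl (funext fun s => ?_)
  have : Fin.castLE (Fin.last T).2.le s = s.castSucc := rfl
  simp only [upTo, extend, this, Fin.snoc_castSucc]

/-! ### Good events and their failure probabilities -/

variable (Q) in
/-- The initial estimates are accurate. -/
def EstGood (C : CDP X A) (s : ℝ) (x : Fin P.nEst → X) : Prop :=
  ∀ f, |estValue Q f x - C.predValue Q f| ≤ s

variable (Q) in
/-- The estimates of the Bellman errors under the chosen function's own policy are accurate. -/
def EvalGood (s : ℝ) (f : F) (d : Fin P.nEval → C.Traj) : Prop :=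
  ∀ h, |estOwnError Q f h d - C.bellmanError Q f (Q.greedy f) h| ≤ s

theorem measurable_estGood [Countable F] (s : ℝ) : Measurable (EstGood Q (P := P) C s) :=
  Measurable.forall fun f => measurableSet_setOfPred.1
    (measurableSet_le ((measurable_estValue f).sub_const _).abs measurable_const)

theorem measurable_evalGood (s : ℝ) (f : F) :
    Measurable fun d : Fin P.nEval → C.Traj => EvalGood Q s f d :=
  Measurable.forall fun h => measurableSet_setOfPred.1
    (measurableSet_le ((measurable_estOwnError f h).sub_const _).abs measurable_const)

variable (Q) in
/-- The level is one with a large estimated Bellman error, if the test is not passed. -/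
def LevelGood (f : F) (d : Fin P.nEval → C.Traj) (h : Fin C.H) : Prop :=
  ¬ Stop Q f d → 5 * P.εStop / (8 * C.H) ≤ estOwnError Q f h d

theorem measurable_levelGood (f : F) (h : Fin C.H) :
    Measurable fun d : Fin P.nEval → C.Traj => LevelGood Q f d h := by
  refine Measurable.imp (Measurable.not (measurableSet_setOfPred.1
    (measurableSet_le ?_ measurable_const))) (measurableSet_setOfPred.1
      (measurableSet_le measurable_const (measurable_estOwnError _ _)))
  exact Finset.measurable_sum _ fun h _ => measurable_estOwnError _ _

section Choices

variable [Fintype A] [DecidableEq A]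

variable (Q) in
/-- The function is chosen optimistically, if some function survives. -/
def PickGood {t : ℕ} (r : Transcript (F := F) C P t) (f : F) : Prop :=
  (alive Q r t).Nonempty → f ∈ alive Q r t ∧ ∀ g ∈ alive Q r t, estValue Q g r.1 ≤ estValue Q f r.1

variable (Q) in
/-- The importance-weighted estimates of the Bellman errors are accurate. -/
def ExplGood (s : ℝ) (f : F) (h : Fin C.H) (d : Fin P.nExpl → C.Traj) : Prop :=
  ∀ g, |estError Q g h d - C.bellmanError Q g (Q.greedy f) h| ≤ s

theorem measurable_explGood [MeasurableSingletonClass A] [Countable F] (s : ℝ) (f : F)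
    (h : Fin C.H) : Measurable fun d : Fin P.nExpl → C.Traj => ExplGood Q s f h d :=
  Measurable.forall fun g => measurableSet_setOfPred.1
    (measurableSet_le ((measurable_estError g h).sub_const _).abs measurable_const)

variable (Q) in
/-- All estimates and choices in an iteration are good. -/
def IterGood (sV sX : ℝ) {t : ℕ} (z : Transcript (F := F) C P t × Iter (F := F) C P) : Prop :=
  PickGood Q z.1 z.2.1 ∧ EvalGood Q sV z.2.1 z.2.2.1 ∧ LevelGood Q z.2.1 z.2.2.1 z.2.2.2.1 ∧
    ExplGood Q sX z.2.1 z.2.2.2.1 z.2.2.2.2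

variable (Q) in
/-- All estimates and choices in a run are good. -/
def RunGood (s₀ sV sX : ℝ) {T : ℕ} (r : Transcript (F := F) C P T) : Prop :=
  EstGood Q C s₀ r.1 ∧ ∀ t : Fin T, IterGood Q sV sX (r.upTo t, r.2 t)

theorem runGood_extend {s₀ sV sX : ℝ} {T : ℕ}
    (z : Transcript (F := F) C P T × Iter (F := F) C P) :
    RunGood Q s₀ sV sX (Transcript.extend z) ↔ RunGood Q s₀ sV sX z.1 ∧ IterGood Q sV sX z := by
  unfold RunGood
  rw [Fin.forall_fin_succ', ← and_assoc, Transcript.upTo_extend_last]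
  simp only [Transcript.upTo_extend_castSucc]
  simp only [Transcript.extend, Fin.snoc_castSucc, Fin.snoc_last, Prod.mk.eta]

theorem runLaw_succ [Nonempty A] [MeasurableSpace F] [Countable F]
    [MeasurableSingletonClass F] (S : Selection C Q P) (T : ℕ) :
    runLaw S (T + 1) = (runLaw S T ⊗ₘ iterKernel S T).map Transcript.extend := rfl

variable [MeasurableSingletonClass A] [MeasurableSpace F]

theorem measurable_mem_alive {T : ℕ} (f : F) (t : ℕ) :
    Measurable fun r : Transcript (F := F) C P T => f ∈ alive Q r t := by
  refine Measurable.forall fun s => Measurable.imp measurable_const ?_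
  refine measurableSet_setOfPred.1 (measurableSet_le (Measurable.abs ?_) measurable_const)
  exact Measurable.of_countable_right (p := fun d h => estError Q f h d)
    (fun h => measurable_estError f h) (by fun_prop) (by fun_prop)

theorem measurable_pickGood [Countable F] {t : ℕ} (f : F) :
    Measurable fun r : Transcript (F := F) C P t => PickGood Q r f := by
  refine Measurable.imp (Measurable.exists fun f => measurable_mem_alive f t)
    (Measurable.and (measurable_mem_alive f t) (Measurable.forall fun g =>
      Measurable.imp (measurable_mem_alive g t) ?_))
  exact measurableSet_setOfPred.1 (measurableSet_le ((measurable_estValue g).comp measurable_fst)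
    ((measurable_estValue f).comp measurable_fst))

variable [MeasurableSingletonClass F] [Countable F]

theorem measurable_iterGood (sV sX : ℝ) {t : ℕ} :
    Measurable (IterGood Q sV sX (t := t) (C := C) (P := P)) := by
  have h1 : Measurable fun z : Transcript (F := F) C P t × F => PickGood Q z.1 z.2 := by
    apply measurable_from_prod_countable_left
    exact fun f => measurable_pickGood f
  have h2 : Measurable fun z : (Fin P.nEval → C.Traj) × F => EvalGood Q sV z.2 z.1 := by
    apply measurable_from_prod_countable_left
    exact fun f => measurable_evalGood sV f
  have h3 : Measurable fun z : (Fin P.nEval → C.Traj) × F × Fin C.H =>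
      LevelGood Q z.2.1 z.1 z.2.2 := by
    apply measurable_from_prod_countable_left
    exact fun q => measurable_levelGood q.1 q.2
  have h4 : Measurable fun z : (Fin P.nExpl → C.Traj) × F × Fin C.H =>
      ExplGood Q sX z.2.1 z.2.2 z.1 := by
    apply measurable_from_prod_countable_left
    exact fun q => measurable_explGood sX q.1 q.2
  have u1 : Measurable fun z : Transcript (F := F) C P t × Iter (F := F) C P => (z.1, z.2.1) := by
    fun_prop
  have u2 : Measurable fun z : Transcript (F := F) C P t × Iter (F := F) C P =>
      (z.2.2.1, z.2.1) := by fun_prop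
  have u3 : Measurable fun z : Transcript (F := F) C P t × Iter (F := F) C P =>
      (z.2.2.1, z.2.1, z.2.2.2.1) := by fun_prop
  have u4 : Measurable fun z : Transcript (F := F) C P t × Iter (F := F) C P =>
      (z.2.2.2.2, z.2.1, z.2.2.2.1) := by fun_prop
  have c1 := h1.comp u1
  have c2 := h2.comp u2
  have c3 := h3.comp u3
  have c4 := h4.comp u4
  have c := c1.and (c2.and (c3.and c4))
  exact c

theorem measurable_runGood (s₀ sV sX : ℝ) {T : ℕ} :
    Measurable (RunGood Q s₀ sV sX (T := T) (C := C) (P := P)) :=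
  ((measurable_estGood s₀).comp measurable_fst).and (Measurable.forall fun t =>
    (measurable_iterGood sV sX).comp ((Transcript.measurable_upTo t).prodMk (by fun_prop)))

variable [Nonempty A]

instance : IsMarkovKernel (evalKernel C Q P) :=
  ⟨fun f => inferInstanceAs
    (IsProbabilityMeasure (Measure.pi fun _ => C.trajLaw (follow (Q.greedy f))))⟩

instance : IsMarkovKernel (explKernel C Q P) :=
  ⟨fun p => inferInstanceAs
    (IsProbabilityMeasure (Measure.pi fun _ => C.trajLaw (explore (Q.greedy p.1) p.2)))⟩

instance (S : Selection C Q P) (t : ℕ) : IsMarkovKernel (S.pick t) := S.pick_markov t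

instance (S : Selection C Q P) (t : ℕ) : IsMarkovKernel (S.level t) := S.level_markov t

instance (S : Selection C Q P) (t : ℕ) : IsMarkovKernel (iterKernel S t) := by
  unfold iterKernel; infer_instance

instance isProbabilityMeasure_runLaw (S : Selection C Q P) (T : ℕ) :
    IsProbabilityMeasure (runLaw S T) := by
  have := C.init_prob
  induction T with
  | zero => exact Measure.isProbabilityMeasure_map (by fun_prop)
  | succ T ih =>
    rw [runLaw_succ]
    exact Measure.isProbabilityMeasure_map Transcript.measurable_extend.aemeasurable

/-- The four stages are peeled off in order. The two free choices violate their specifications with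
probability zero, and the two samples are fresh given the chosen function and level, so bounds
uniform in these suffice despite the adaptivity. -/
theorem iterKernel_not_iterGood_le (S : Selection C Q P) {sV sX : ℝ} {eV eX : ℝ≥0∞}
    (hV : ∀ f, evalKernel C Q P f {d | ¬ EvalGood Q sV f d} ≤ eV)
    (hX : ∀ f h, explKernel C Q P (f, h) {d | ¬ ExplGood Q sX f h d} ≤ eX)
    {t : ℕ} (r : Transcript (F := F) C P t) :
    iterKernel S t r {i | ¬ IterGood Q sV sX (r, i)} ≤ eV + eX := by
  have hm : MeasurableSet {i | ¬ IterGood Q sV sX (r, i)} :=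
    (measurableSet_setOfPred.2 ((measurable_iterGood sV sX).comp measurable_prodMk_left)).compl
  unfold iterKernel
  rw [← zero_add (eV + eX)]
  refine Kernel.compProd_apply_le_add _ _ _ hm (B := {f | ¬ PickGood Q r f}) ?_ fun f hf => ?_
  · by_cases hr : (alive Q r t).Nonempty
    · refine (le_of_eq (ae_iff.1 ?_))
      filter_upwards [S.pick_spec t r hr] with f hf _ using hf
    · simp [PickGood, hr]
  replace hm := hm.preimage (measurable_prodMk_left (x := f))
  refine Kernel.compProd_apply_le_add _ _ _ hm (B := {d | ¬ EvalGood Q sV f d}) (hV f)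
    fun d hd => ?_
  replace hm := hm.preimage (measurable_prodMk_left (x := d))
  rw [← zero_add eX]
  refine Kernel.compProd_apply_le_add _ _ _ hm (B := {h | ¬ LevelGood Q f d h}) ?_ fun h hh => ?_
  · by_cases hs : Stop Q f d
    · simp [LevelGood, hs]
    · refine (le_of_eq (ae_iff.1 ?_))
      filter_upwards [S.level_spec t r f d hs] with h hh _ using hh
  refine (measure_mono ?_).trans (hX f h)
  intro d' (hd' : ¬ IterGood Q sV sX (r, f, d, h, d')) (hg : ExplGood Q sX f h d')
  exact hd' ⟨not_not.1 hf, not_not.1 hd, not_not.1 hh, hg⟩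

/-- Each iteration adds the same failure probability whatever the transcript so far, and iterations
after halting are counted too. -/
theorem runLaw_not_runGood_le (S : Selection C Q P) {s₀ sV sX : ℝ} {e₀ eV eX : ℝ≥0∞}
    (h₀ : Measure.pi (fun _ : Fin P.nEst => C.init) {x | ¬ EstGood Q C s₀ x} ≤ e₀)
    (hV : ∀ f, evalKernel C Q P f {d | ¬ EvalGood Q sV f d} ≤ eV)
    (hX : ∀ f h, explKernel C Q P (f, h) {d | ¬ ExplGood Q sX f h d} ≤ eX) (T : ℕ) :
    runLaw S T {r | ¬ RunGood Q s₀ sV sX r} ≤ e₀ + T * (eV + eX) := by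
  induction T with
  | zero =>
    have hm : MeasurableSet {r : Transcript (F := F) C P 0 | ¬ RunGood Q s₀ sV sX r} :=
      (measurableSet_setOfPred.2 (measurable_runGood s₀ sV sX)).compl
    rw [runLaw, Measure.map_apply (by fun_prop) hm]
    refine (measure_mono ?_).trans (h₀.trans (by simp))
    intro x (hx : ¬ RunGood Q s₀ sV sX (x, Fin.elim0)) (hg : EstGood Q C s₀ x)
    exact hx ⟨hg, fun t => t.elim0⟩
  | succ T ih =>
    have hm : MeasurableSet {r : Transcript (F := F) C P (T + 1) | ¬ RunGood Q s₀ sV sX r} :=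
      (measurableSet_setOfPred.2 (measurable_runGood s₀ sV sX)).compl
    have hm1 : MeasurableSet {r : Transcript (F := F) C P T | ¬ RunGood Q s₀ sV sX r} :=
      (measurableSet_setOfPred.2 (measurable_runGood s₀ sV sX)).compl
    have hm2 : MeasurableSet {z : Transcript (F := F) C P T × Iter (F := F) C P |
        ¬ IterGood Q sV sX z} := (measurableSet_setOfPred.2 (measurable_iterGood sV sX)).compl
    rw [runLaw_succ, Measure.map_apply Transcript.measurable_extend hm]
    have hsub : Transcript.extend ⁻¹' {r | ¬ RunGood Q s₀ sV sX r} ⊆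
        Prod.fst ⁻¹' {r : Transcript (F := F) C P T | ¬ RunGood Q s₀ sV sX r} ∪
          {z | ¬ IterGood Q sV sX z} := by
      intro z hz
      have hz' : ¬ RunGood Q s₀ sV sX (Transcript.extend z) := hz
      rw [runGood_extend, not_and_or] at hz'
      exact hz'
    refine (measure_mono hsub).trans ((measure_union_le _ _).trans ?_)
    have h1 : (runLaw S T ⊗ₘ iterKernel S T)
        (Prod.fst ⁻¹' {r | ¬ RunGood Q s₀ sV sX r}) ≤ e₀ + T * (eV + eX) := by
      rw [← Measure.fst_apply hm1, Measure.fst_compProd]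
      exact ih
    have h2 : (runLaw S T ⊗ₘ iterKernel S T) {z | ¬ IterGood Q sV sX z} ≤ eV + eX := by
      rw [Measure.compProd_apply hm2]
      refine (lintegral_mono fun r => iterKernel_not_iterGood_le S hV hX r).trans ?_
      simp
    refine (add_le_add h1 h2).trans (le_of_eq ?_)
    push_cast
    ring

end Choices

end Oliver

end

noncomputable section

/-! ## Accuracy of the estimates -/

theorem measure_not_forall_le {Ω ι : Type*} [MeasurableSpace Ω] [Fintype ι] {μ : Measure Ω}
    {G : ι → Ω → Prop} {e q : ℝ} (h : ∀ i, μ {x | ¬ G i x} ≤ 2 * ENNReal.ofReal (Real.exp (-e)))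
    (hq : Fintype.card ι * (2 * Real.exp (-e)) ≤ q) :
    μ {x | ¬ ∀ i, G i x} ≤ ENNReal.ofReal q := by
  have hsub : {x | ¬ ∀ i, G i x} = ⋃ i, {x | ¬ G i x} := by
    ext x; simp
  rw [hsub]
  refine (measure_iUnion_fintype_le _ _).trans ((Finset.sum_le_sum fun i _ => h i).trans ?_)
  rw [Finset.sum_const, nsmul_eq_mul, Finset.card_univ]
  refine le_trans (le_of_eq ?_) (ENNReal.ofReal_le_ofReal hq)
  rw [ENNReal.ofReal_mul (by positivity), ENNReal.ofReal_mul (by norm_num)]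
  simp

theorem exp_neg_le_inv {e y : ℝ} (hy : 0 < y) (h : Real.log y ≤ e) : Real.exp (-e) ≤ y⁻¹ := by
  rw [Real.exp_neg]
  exact inv_anti₀ hy ((Real.log_le_iff_le_exp hy).1 h)

namespace Oliver

variable {X : Type u} {A : Type v} {F : Type w} [MeasurableSpace X] [MeasurableSpace A]
  {C : CDP X A} (Q : QClass X A F) {P : OliverParams}

theorem measure_not_estGood_le [Fintype F] [Nonempty F] {ε δ : ℝ} (hε : 0 < ε) (hδ : 0 < δ)
    (hn : 0 < P.nEst) (hP : 32 / ε ^ 2 * Real.log (6 * Fintype.card F / δ) ≤ P.nEst) :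
    Measure.pi (fun _ : Fin P.nEst => C.init) {x | ¬ EstGood Q C (ε / 8) x} ≤
      ENNReal.ofReal (δ / 3) := by
  have := C.init_prob
  have hN : (0 : ℝ) < Fintype.card F := by exact_mod_cast Fintype.card_pos
  refine measure_not_forall_le (e := P.nEst * (2 * (ε / 8) ^ 2 / (1 - 0) ^ 2)) (fun f => ?_) ?_
  · have hπ := (Q.greedy f).2
    exact hoeffding_empiricalMean (μ := C.init) (g := fun x => Q.q f x ((Q.greedy f).1 x)) hn
      (CDP.measurable_q_comp Q f (by fun_prop) (by fun_prop))
      one_pos (by positivity) (Filter.Eventually.of_forall fun x => Q.q_mem f _ _)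
  · have h1 : Real.log (6 * Fintype.card F / δ) ≤ P.nEst * (2 * (ε / 8) ^ 2 / (1 - 0) ^ 2) := by
      have := mul_le_mul_of_nonneg_right hP (show 0 ≤ 2 * (ε / 8) ^ 2 / (1 - 0) ^ 2 by positivity)
      refine le_trans (le_of_eq ?_) this
      field_simp
      ring
    refine (mul_le_mul_of_nonneg_left (mul_le_mul_of_nonneg_left
      (exp_neg_le_inv (by positivity) h1) zero_le_two) hN.le).trans (le_of_eq ?_)
    field_simp
    ring

variable [MeasurableSpace F] [MeasurableSingletonClass F]

/-- Hoeffding for residuals in an interval of length `3`, with a union over the `H` levels only: the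
function is fixed before these data are drawn. -/
theorem evalKernel_not_evalGood_le [Countable F] (hC : C.BoundedRewards) {ε δ ℓ : ℝ} {M : ℕ}
    (hε : 0 < ε) (hδ : 0 < δ) (hℓ : 0 < ℓ) (hM : 0 < M) (hH : 0 < C.H) (hn : 0 < P.nEval)
    (hP : 288 * C.H ^ 2 / ε ^ 2 * Real.log (12 * C.H ^ 2 * M * ℓ / δ) ≤ P.nEval) (f : F) :
    evalKernel C Q P f {d | ¬ EvalGood Q (ε / (8 * C.H)) f d} ≤
      ENNReal.ofReal (δ / (6 * C.H * M * ℓ)) := by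
  have hH' : (0 : ℝ) < C.H := by exact_mod_cast hH
  have hM' : (0 : ℝ) < M := by exact_mod_cast hM
  refine measure_not_forall_le (e := P.nEval * (2 * (ε / (8 * C.H)) ^ 2 / (1 - (-2)) ^ 2))
    (fun h => ?_) ?_
  · rw [CDP.bellmanError, rollIn_self]
    exact hoeffding_empiricalMean (μ := C.trajLaw (follow (Q.greedy f))) hn
      (CDP.measurable_residual Q f h)
      (by norm_num) (by positivity) (CDP.ae_residual_mem Q hC _ f h)
  · have h1 : Real.log (12 * C.H ^ 2 * M * ℓ / δ) ≤
        P.nEval * (2 * (ε / (8 * C.H)) ^ 2 / (1 - (-2)) ^ 2) := by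
      have := mul_le_mul_of_nonneg_right hP
        (show 0 ≤ 2 * (ε / (8 * C.H)) ^ 2 / (1 - (-2)) ^ 2 by positivity)
      refine le_trans (le_of_eq ?_) this
      field_simp
      ring
    rw [Fintype.card_fin]
    refine (mul_le_mul_of_nonneg_left (mul_le_mul_of_nonneg_left
      (exp_neg_le_inv (by positivity) h1) zero_le_two) hH'.le).trans (le_of_eq ?_)
    field_simp
    ring

/-- Bernstein with second moment `4K` and range `2K`, and a union over all of `F`, because every
function is tested on the same sample. -/
theorem explKernel_not_explGood_le [Fintype F] [MeasurableSingletonClass A] [Fintype A]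
    [DecidableEq A] [Nonempty A] (hC : C.BoundedRewards) {ε δ ℓ : ℝ} {M : ℕ}
    (hε : 0 < ε) (hε1 : ε ≤ 1) (hδ : 0 < δ) (hδ1 : δ ≤ 1) (hℓ : 1 ≤ ℓ) (hM : 0 < M)
    (hH : 0 < C.H) (hn : 0 < P.nExpl)
    (hP : 4608 * C.H ^ 2 * M * Fintype.card A / ε ^ 2 *
      Real.log (12 * Fintype.card F * C.H * M * ℓ / δ) ≤ P.nExpl) (f : F) (h : Fin C.H) :
    explKernel C Q P (f, h) {d | ¬ ExplGood Q (ε / (12 * C.H * √M)) f h d} ≤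
      ENNReal.ofReal (δ / (72 * C.H * M * ℓ)) := by
  have : Nonempty F := ⟨f⟩
  have hH' : (1 : ℝ) ≤ C.H := by exact_mod_cast hH
  have hM' : (1 : ℝ) ≤ M := by exact_mod_cast hM
  have hM2 : 1 ≤ √(M : ℝ) := Real.one_le_sqrt.2 hM'
  have hK : (0 : ℝ) < Fintype.card A := by exact_mod_cast Fintype.card_pos
  have hN : (1 : ℝ) ≤ Fintype.card F := by exact_mod_cast Fintype.card_pos
  set φ := ε / (12 * C.H * √(M : ℝ)) with hφ
  have hφ0 : 0 < φ := by positivity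
  have hφ1 : φ ≤ 1 := by
    rw [hφ, div_le_one (by positivity)]
    nlinarith [mul_le_mul hH' hM2 zero_le_one (by positivity)]
  refine measure_not_forall_le (e := P.nExpl * (φ ^ 2 / (4 * (4 * Fintype.card A))))
    (fun g => ?_) ?_
  · rw [← CDP.integral_weightedResidual]
    exact bernstein_empiricalMean (μ := C.trajLaw (explore (Q.greedy f) h))
      (B := 2 * Fintype.card A) hn (CDP.measurable_weightedResidual Q g h)
      (by positivity) hφ0.le (by nlinarith)
      (CDP.ae_abs_weightedResidual_le Q hC g (Q.greedy f) h)
      (CDP.integral_weightedResidual_sq_le Q hC g (Q.greedy f) h)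
  · set y := 12 * Fintype.card F * C.H * M * ℓ / δ with hy
    have hy12 : 12 ≤ y := by
      rw [hy, le_div_iff₀ hδ]
      have : 1 ≤ Fintype.card F * (C.H : ℝ) * M * ℓ :=
        one_le_mul_of_one_le_of_one_le (one_le_mul_of_one_le_of_one_le
          (one_le_mul_of_one_le_of_one_le hN hH') hM') hℓ
      nlinarith
    have hs : √(M : ℝ) ^ 2 = M := Real.sq_sqrt (by positivity)
    -- The sample size makes the Bernstein exponent at least `2 log y`. One factor `1/y` gives the
    -- wanted probability, and the other is used only through `1/y ≤ 1/12`.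
    have h1 : Real.log (y * y) ≤ P.nExpl * (φ ^ 2 / (4 * (4 * Fintype.card A))) := by
      rw [Real.log_mul (by positivity) (by positivity), ← two_mul]
      have := mul_le_mul_of_nonneg_right hP
        (show 0 ≤ φ ^ 2 / (4 * (4 * (Fintype.card A : ℝ))) by positivity)
      refine le_trans (le_of_eq ?_) this
      rw [hφ, div_pow, mul_pow, mul_pow, hs]
      field_simp
      ring
    have hy0 : 0 < y := by linarith
    refine (mul_le_mul_of_nonneg_left (mul_le_mul_of_nonneg_left
      (exp_neg_le_inv (by positivity) h1) zero_le_two) (by positivity)).trans ?_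
    have h2 : (y * y)⁻¹ ≤ 1 / 12 * y⁻¹ := by
      rw [mul_inv]
      gcongr
      rw [one_div]
      exact inv_anti₀ (by norm_num) hy12
    refine (mul_le_mul_of_nonneg_left (mul_le_mul_of_nonneg_left h2 zero_le_two)
      (by positivity)).trans (le_of_eq ?_)
    rw [hy]
    field_simp
    ring

end Oliver

end

noncomputable section

/-! ## Analysis of a good run -/

namespace Oliver

variable {X : Type u} {A : Type v} {F : Type w} [MeasurableSpace X] [MeasurableSpace A]
  {C : CDP X A} {Q : QClass X A F} {P : OliverParams} [Fintype A] [DecidableEq A]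

theorem mem_alive_upTo {T : ℕ} {r : Transcript (F := F) C P T} {t : Fin T} {f : F} :
    f ∈ alive Q (r.upTo t) t ↔ f ∈ alive Q r t :=
  ⟨fun h s hs => h ⟨s, hs⟩ hs, fun h s _ => h (Fin.castLE t.2.le s) s.2⟩

/-- Valid functions survive in a good run. -/
theorem RunGood.mem_alive_of_isValid {s₀ sV : ℝ} {T : ℕ} {r : Transcript (F := F) C P T}
    (hr : RunGood Q s₀ sV P.φ r) {f : F} (hf : C.IsValid Q P.θ f) (t : ℕ) : f ∈ alive Q r t := by
  intro s _
  have h1 : |estError Q f (r.2 s).2.2.1 (r.2 s).2.2.2 -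
      C.bellmanError Q f (Q.greedy (r.2 s).1) (r.2 s).2.2.1| ≤ P.φ := (hr.2 s).2.2.2 f
  have h2 := hf (r.2 s).1 (r.2 s).2.2.1
  rw [abs_le] at *
  constructor <;> linarith [h1.1, h1.2, h2.1, h2.2]

theorem RunGood.pick {s₀ sV sX : ℝ} {T : ℕ} {r : Transcript (F := F) C P T}
    (hr : RunGood Q s₀ sV sX r) (t : Fin T) {f : F} (hf : f ∈ alive Q r t) :
    (r.2 t).1 ∈ alive Q r t ∧ estValue Q f r.1 ≤ estValue Q (r.2 t).1 r.1 := by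
  have h : (r.2 t).1 ∈ alive Q (r.upTo t) t ∧
      ∀ g ∈ alive Q (r.upTo t) t, estValue Q g r.1 ≤ estValue Q (r.2 t).1 r.1 :=
    (hr.2 t).1 ⟨f, mem_alive_upTo.2 hf⟩
  exact ⟨mem_alive_upTo.1 h.1, h.2 f (mem_alive_upTo.2 hf)⟩

/-- If the algorithm stops, then the returned policy is near-optimal. -/
theorem RunGood.value_ge_of_stop [MeasurableSingletonClass A] {ε : ℝ} {T : ℕ}
    {r : Transcript (F := F) C P T} (hC : C.BoundedRewards) (hH : 0 < C.H)
    (hr : RunGood Q (ε / 8) (ε / (8 * C.H)) P.φ r) {f : F} (hf : C.IsValid Q P.θ f) {t : Fin T}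
    (hs : Stop Q (r.2 t).1 (r.2 t).2.1) :
    C.value (Q.greedy f) - (C.H * P.θ + 5 * P.εStop / 8 + 3 * ε / 8) ≤
      C.value (Q.greedy (r.2 t).1) := by
  have hH' : (0 : ℝ) < C.H := by exact_mod_cast hH
  have h1 := CDP.sum_bellmanError_greedy Q hC hH f
  have h2 := CDP.sum_bellmanError_greedy Q hC hH (r.2 t).1
  have h3 : -(C.H * P.θ) ≤ ∑ h, C.bellmanError Q f (Q.greedy f) h := by
    have := Finset.sum_le_sum fun h (_ : h ∈ Finset.univ) => (abs_le.1 (hf f h)).1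
    simpa using this
  have h4 : ∑ h, C.bellmanError Q (r.2 t).1 (Q.greedy (r.2 t).1) h ≤
      ∑ h, estOwnError Q (r.2 t).1 h (r.2 t).2.1 + ε / 8 := by
    have hle : ∀ h, C.bellmanError Q (r.2 t).1 (Q.greedy (r.2 t).1) h ≤
        estOwnError Q (r.2 t).1 h (r.2 t).2.1 + ε / (8 * C.H) := fun h => by
      have := (abs_le.1 ((hr.2 t).2.1 h)).1
      linarith
    refine (Finset.sum_le_sum fun h _ => hle h).trans (le_of_eq ?_)
    rw [Finset.sum_add_distrib, Finset.sum_const, Finset.card_univ, Fintype.card_fin, nsmul_eq_mul]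
    congr 1
    field_simp
  have h5 := (hr.pick t (hr.mem_alive_of_isValid hf t)).2
  have h6 := abs_le.1 (hr.1 f)
  have h7 := abs_le.1 (hr.1 (r.2 t).1)
  have h8 : ∑ h, estOwnError Q (r.2 t).1 h (r.2 t).2.1 ≤ 5 * P.εStop / 8 := hs
  -- The slack `3 * ε / 8` consists of two errors of predicted values and the total error of the
  -- evaluation estimates.
  linarith [h6.1, h6.2, h7.1, h7.2]

open Matrix in
/-- A good run explores a level only a bounded number of times. -/
theorem RunGood.card_level_le [Finite F] {M : ℕ} {ζ η ε s₀ : ℝ} {T : ℕ}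
    {r : Transcript (F := F) C P T} (hH : 0 < C.H) (hM : 0 < M) (hε : 0 < ε)
    (hθ : 0 ≤ P.θ) (hη : 0 ≤ η) (hφ : P.φ = ε / (12 * C.H * √M))
    (hStop : P.εStop = ε + 2 * C.H * (3 * √M * (P.θ + η) + η))
    (hL : 1 ≤ 6 * C.H * √M * ζ / ε)
    (hr : RunGood Q s₀ (ε / (8 * C.H)) P.φ r) (hvalid : ∃ f, C.IsValid Q P.θ f)
    {h : Fin C.H} {p b : F → EuclideanSpace ℝ (Fin M)}
    (hpb : ∀ f f₂, |C.bellmanError Q f (Q.greedy f₂) h - inner ℝ (p f₂) (b f)| ≤ η ∧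
      ‖p f₂‖ * ‖b f‖ ≤ ζ)
    {I : Finset (Fin T)} (hI : ∀ t ∈ I, (r.2 t).2.2.1 = h ∧ ¬ Stop Q (r.2 t).1 (r.2 t).2.1) :
    (I.card : ℝ) ≤ 2 * M * Real.log (6 * C.H * √M * ζ / ε) := by
  have hH' : (0 : ℝ) < C.H := by exact_mod_cast hH
  have hM' : (1 : ℝ) ≤ M := by exact_mod_cast hM
  have hM2 : 1 ≤ √(M : ℝ) := Real.one_le_sqrt.2 hM'
  rcases I.eq_empty_or_nonempty with rfl | ⟨t₀, ht₀⟩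
  · simp only [Finset.card_empty, Nat.cast_zero]
    have := Real.log_nonneg hL
    positivity
  have : Nonempty F := ⟨(r.2 t₀).1⟩
  have : NeZero M := ⟨hM.ne'⟩
  obtain ⟨f₀, hf₀⟩ := hvalid
  -- Elimination threshold `φ + θ`, plus estimation error `φ`, plus factorization error `η`.
  set β := 2 * P.φ + P.θ + η with hβ
  have hφ0 : 0 < P.φ := by rw [hφ]; positivity
  have hβ0 : 0 < β := by positivity
  have hsmall : ∀ s ∈ I, ∀ t ∈ I, s < t → |inner ℝ (p (r.2 s).1) (b (r.2 t).1)| ≤ β := by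
    intro s hs t ht hst
    have h1 : |estError Q (r.2 t).1 (r.2 s).2.2.1 (r.2 s).2.2.2| ≤ P.φ + P.θ :=
      (hr.pick t (hr.mem_alive_of_isValid hf₀ t)).1 s hst
    have h2 : |estError Q (r.2 t).1 (r.2 s).2.2.1 (r.2 s).2.2.2 -
        C.bellmanError Q (r.2 t).1 (Q.greedy (r.2 s).1) (r.2 s).2.2.1| ≤ P.φ :=
      (hr.2 s).2.2.2 (r.2 t).1
    rw [(hI s hs).1] at h1 h2
    have h3 := (hpb (r.2 t).1 (r.2 s).1).1
    rw [abs_le] at *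
    constructor <;> linarith [h1.1, h1.2, h2.1, h2.2, h3.1, h3.2]
  -- The definition of `εStop` is calibrated for this: after losing `ε / (8H)` to estimation and `η`
  -- to factorization, the threshold still leaves `ε / (2H) + 3√M(θ + η)`, which is `3√M β`.
  have hlarge : ∀ t ∈ I, 3 * √(M : ℝ) * β ≤ inner ℝ (p (r.2 t).1) (b (r.2 t).1) := by
    intro t ht
    have h1 : 5 * P.εStop / (8 * C.H) ≤ estOwnError Q (r.2 t).1 (r.2 t).2.2.1 (r.2 t).2.1 :=
      (hr.2 t).2.2.1 (hI t ht).2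
    rw [(hI t ht).1] at h1
    have h2 : |estOwnError Q (r.2 t).1 h (r.2 t).2.1 -
        C.bellmanError Q (r.2 t).1 (Q.greedy (r.2 t).1) h| ≤ ε / (8 * C.H) := (hr.2 t).2.1 h
    have h3 := abs_le.1 (hpb (r.2 t).1 (r.2 t).1).1
    have h4 := (abs_le.1 h2).2
    have h5 : 3 * √(M : ℝ) * (2 * P.φ) = ε / (2 * C.H) := by
      rw [hφ]; field_simp; ring
    have h6 : ε / (2 * C.H) + 3 * √(M : ℝ) * (P.θ + η) + η + ε / (8 * C.H) ≤
        5 * P.εStop / (8 * C.H) := by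
      rw [hStop]
      have : 5 * (ε + 2 * C.H * (3 * √(M : ℝ) * (P.θ + η) + η)) / (8 * C.H) =
          ε / (2 * C.H) + ε / (8 * C.H) + 5 / 4 * (3 * √(M : ℝ) * (P.θ + η) + η) := by
        field_simp; ring
      rw [this]
      have : 0 ≤ 3 * √(M : ℝ) * (P.θ + η) + η := by positivity
      linarith
    have h7 : 3 * √(M : ℝ) * β = 3 * √(M : ℝ) * (2 * P.φ) + 3 * √(M : ℝ) * (P.θ + η) := by
      rw [hβ]; ring
    linarith [h3.2]
  -- The two norms can be maximized separately: the factorization bounds the product by `ζ` for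
  -- every pair of functions, hence also for the pair of maximizers.
  obtain ⟨g₁, hg₁⟩ := Finite.exists_max fun f => ‖p f‖
  obtain ⟨g₂, hg₂⟩ := Finite.exists_max fun f => ‖b f‖
  have hPB : 3 * √(M : ℝ) * β ≤ ‖p g₁‖ * ‖b g₂‖ :=
    (hlarge t₀ ht₀).trans ((real_inner_le_norm _ _).trans
      (mul_le_mul (hg₁ _) (hg₂ _) (norm_nonneg _) (norm_nonneg _)))
  have hβPB : β ≤ ‖p g₁‖ * ‖b g₂‖ := by nlinarith
  have hB : 0 < ‖b g₂‖ := by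
    rcases (norm_nonneg (b g₂)).lt_or_eq with h | h
    · exact h
    · rw [← h, mul_zero] at hβPB; linarith
  have hdot : ∀ x y : EuclideanSpace ℝ (Fin M), x.ofLp ⬝ᵥ y.ofLp = inner ℝ x y := by
    intro x y
    simp [PiLp.inner_apply, dotProduct, mul_comm]
  -- Increasing enumeration of `I`; the default `t₀` lies in `I`, so membership holds for every
  -- index.
  let e : ℕ → Fin T := fun j => if hj : j < I.card then I.orderEmbOfFin rfl ⟨j, hj⟩ else t₀
  have he : ∀ j, e j ∈ I := by
    intro j
    by_cases hj : j < I.card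
    · simp only [e, hj, dif_pos]; exact I.orderEmbOfFin_mem rfl _
    · simpa only [e, hj, dif_neg, not_false_eq_true] using ht₀
  have hlt : ∀ j < I.card, ∀ i < j, e i < e j := by
    intro j hj i hij
    simp only [e, hj, hij.trans hj, dif_pos]
    exact (I.orderEmbOfFin rfl).strictMono hij
  have key := card_le_of_dotProduct_gap (ι := Fin M) (n := I.card)
    (p := fun j => (p (r.2 (e j)).1).ofLp) (x := fun j => (b (r.2 (e j)).1).ofLp)
    (β := β) (P := ‖p g₁‖) (B := ‖b g₂‖) hβ0 hB (norm_nonneg _)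
    (fun t _ => by
      rw [hdot, real_inner_self_eq_norm_sq]
      exact pow_le_pow_left₀ (norm_nonneg _) (hg₁ _) 2)
    (fun t _ => by
      rw [hdot, real_inner_self_eq_norm_sq]
      exact pow_le_pow_left₀ (norm_nonneg _) (hg₂ _) 2)
    hβPB
    (fun t ht s hst => by rw [hdot]; exact hsmall _ (he s) _ (he t) (hlt t ht s hst))
    (fun t _ => by rw [hdot, Fintype.card_fin]; exact hlarge _ (he t))
  rw [Fintype.card_fin] at key
  refine key.trans (mul_le_mul_of_nonneg_left (Real.log_le_log (div_pos (hβ0.trans_le hβPB) hβ0) ?_)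
    (by positivity))
  have h1 : ‖p g₁‖ * ‖b g₂‖ ≤ ζ := (hpb g₂ g₁).2
  have h2 : 2 * P.φ ≤ β := by rw [hβ]; linarith
  have h3 : 6 * C.H * √(M : ℝ) * ζ / ε = ζ / (2 * P.φ) := by
    rw [hφ]; field_simp; ring
  rw [h3]
  exact div_le_div₀ (le_trans (by positivity) h1) h1 (by positivity) h2

/-- A good run of the required length contains an iteration in which the algorithm halts. -/
theorem RunGood.exists_haltsAt [Finite F] {M : ℕ} {ζ η ε s₀ : ℝ} {T : ℕ}
    {r : Transcript (F := F) C P T} (hH : 0 < C.H) (hM : 0 < M) (hε : 0 < ε)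
    (hθ : 0 ≤ P.θ) (hη : 0 ≤ η) (hφ : P.φ = ε / (12 * C.H * √M))
    (hStop : P.εStop = ε + 2 * C.H * (3 * √M * (P.θ + η) + η))
    (hL : 1 ≤ 6 * C.H * √M * ζ / ε)
    (hr : RunGood Q s₀ (ε / (8 * C.H)) P.φ r) (hvalid : ∃ f, C.IsValid Q P.θ f)
    (hfac : C.HasBellmanFactorization Q M ζ η)
    (hT : 2 * C.H * M * Real.log (6 * C.H * √M * ζ / ε) < T) :
    ∃ t : Fin T, HaltsAt Q r t ∧ (t : ℝ) ≤ 2 * C.H * M * Real.log (6 * C.H * √M * ζ / ε) := by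
  obtain ⟨p, b, hpb⟩ := hfac
  have hcard : ∀ I : Finset (Fin T), (∀ t ∈ I, ¬ Stop Q (r.2 t).1 (r.2 t).2.1) →
      (I.card : ℝ) ≤ 2 * C.H * M * Real.log (6 * C.H * √M * ζ / ε) := by
    intro I hI
    -- Iterations that fail the test are sorted by explored level, and each of the `H` fibers is
    -- bounded by the ellipsoid argument.
    have h1 := Finset.card_eq_sum_card_fiberwise (f := fun t => (r.2 t).2.2.1) (s := I)
      (t := Finset.univ) (by simp [Set.MapsTo])
    rw [h1]
    push_cast
    refine (Finset.sum_le_sum fun h _ => RunGood.card_level_le hH hM hε hθ hη hφ hStop hL hr hvalid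
      (fun f f₂ => hpb h f f₂) (I := {t ∈ I | (r.2 t).2.2.1 = h}) fun t ht => ?_).trans
        (le_of_eq ?_)
    · rw [Finset.mem_filter] at ht
      exact ⟨ht.2, hI t ht.1⟩
    · rw [Finset.sum_const, Finset.card_univ, Fintype.card_fin, nsmul_eq_mul]
      ring
  have hex : ∃ t : Fin T, Stop Q (r.2 t).1 (r.2 t).2.1 := by
    by_contra! hne
    have := hcard Finset.univ fun t _ => hne t
    rw [Finset.card_univ, Fintype.card_fin] at this
    linarith
  classical
  obtain ⟨t, ht, hmin⟩ := Finset.exists_minimal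
    (s := Finset.univ.filter fun t : Fin T => Stop Q (r.2 t).1 (r.2 t).2.1)
    (by obtain ⟨t, ht⟩ := hex; exact ⟨t, by simpa using ht⟩)
  have hfirst : ∀ s : Fin T, s < t → ¬ Stop Q (r.2 s).1 (r.2 s).2.1 := by
    intro s hst hs
    exact absurd (hmin (by simpa using hs) hst.le) (not_le.2 hst)
  obtain ⟨f₀, hf₀⟩ := hvalid
  refine ⟨t, ⟨⟨f₀, hr.mem_alive_of_isValid hf₀ t⟩, by simpa using ht, hfirst⟩, ?_⟩
  -- There are exactly `t` iterations before the first success, all failing the test; hence the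
  -- bound on `t` itself.
  have := hcard (Finset.Iio t) fun s hs => hfirst s (Finset.mem_Iio.1 hs)
  simpa using this

end Oliver

end

noncomputable section

/-! ## The number of episodes -/

theorem natCeil_mul_le {a G : ℝ} (ha : 1 ≤ a) {x : ℝ} (hG : 1 ≤ G) (hx : x ≤ G) :
    ((⌈a * x⌉₊ : ℕ) : ℝ) ≤ (a + 1) * G := by
  have h : ⌈a * x⌉₊ ≤ ⌈a * G⌉₊ := Nat.ceil_mono (by gcongr)
  have h2 := (Nat.ceil_lt_add_one (show 0 ≤ a * G by positivity)).le
  have h3 : ((⌈a * x⌉₊ : ℕ) : ℝ) ≤ (⌈a * G⌉₊ : ℕ) := by exact_mod_cast h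
  linarith

-- The exploration rounds determine the order: about `HM log L` iterations of `H ^ 2 M K / ε ^ 2`
-- episodes. One factor `Y` comes from the iteration count, another from the logarithms in the
-- sample sizes, so the polylogarithmic exponent is `2`.
set_option maxHeartbeats 1000000 in
theorem episodes_oliverParams_le {H K N M t : ℕ} {ζ θ η ε δ : ℝ} (hH : 1 ≤ H) (hK : 1 ≤ K)
    (hN : 1 ≤ N) (hM : 1 ≤ M) (hε : 0 < ε) (hε1 : ε < 1) (hδ : 0 < δ) (hδ1 : δ < 1)
    (hL : Real.exp 1 ≤ 6 * H * √M * ζ / ε)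
    (ht : (t : ℝ) ≤ 2 * H * M * Real.log (6 * H * √M * ζ / ε)) :
    (Oliver.episodes (oliverParams H K N M ζ θ η ε δ) t : ℝ) ≤
      700000 * ((M : ℝ) ^ 2 * (H : ℝ) ^ 3 * K / ε ^ 2) * Real.log (2 + N * ζ / δ) *
        Real.log (2 + M * H * (1 + ζ) / ε) ^ 2 := by
  have hH' : (1 : ℝ) ≤ H := by exact_mod_cast hH
  have hK' : (1 : ℝ) ≤ K := by exact_mod_cast hK
  have hN' : (1 : ℝ) ≤ N := by exact_mod_cast hN
  have hM' : (1 : ℝ) ≤ M := by exact_mod_cast hM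
  have hs1 : 1 ≤ √(M : ℝ) := Real.one_le_sqrt.2 hM'
  have hsM : √(M : ℝ) ≤ M := by
    rw [Real.sqrt_le_left (by positivity)]; exact le_self_pow₀ hM' two_ne_zero
  set L := 6 * H * √(M : ℝ) * ζ / ε with hLdef
  set ℓ := Real.log L with hℓdef
  have hL0 : 0 < L := (Real.exp_pos 1).trans_le hL
  have hℓ : 1 ≤ ℓ := (Real.le_log_iff_exp_le hL0).2 hL
  have hζ : 0 < ζ := by
    by_contra hneg
    have : L ≤ 0 := div_nonpos_of_nonpos_of_nonneg
      (mul_nonpos_of_nonneg_of_nonpos (by positivity) (not_lt.1 hneg)) hε.le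
    linarith
  set y := 2 + M * H * (1 + ζ) / ε with hy
  set w := 2 + N * ζ / δ with hw
  set Y := Real.log y with hY
  set W := Real.log w with hW
  have hMHε : 1 ≤ M * H / ε := by
    rw [le_div_iff₀ hε, one_mul]
    exact hε1.le.trans (one_le_mul_of_one_le_of_one_le hM' hH')
  have hy_split : y = 2 + M * H / ε + M * H / ε * ζ := by rw [hy]; ring
  have hζ' : 0 < M * H / ε * ζ := by positivity
  have hy3 : 3 ≤ y := by linarith
  have hy0 : 0 < y := by linarith
  have hw2 : 2 ≤ w := le_add_of_nonneg_right (by positivity)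
  have hw0 : 0 < w := by linarith
  have he3 := Real.exp_one_lt_d9
  have hY1 : 1 ≤ Y := (Real.le_log_iff_exp_le hy0).2 (by linarith)
  have hW1 : 1 / 2 ≤ W := by
    have := Real.log_le_log (by norm_num) hw2
    have := Real.log_two_gt_d9
    linarith
  have he7 : (432 : ℝ) ≤ Real.exp 7 := by
    have h1 := Real.exp_one_gt_d9
    have h2 : Real.exp 7 = Real.exp 1 ^ 7 := by rw [← Real.exp_nat_mul]; norm_num
    rw [h2]
    calc (432 : ℝ) ≤ 2.7 ^ 7 := by norm_num
      _ ≤ _ := pow_le_pow_left₀ (by norm_num) (by linarith) 7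
  have he2 : (6 : ℝ) ≤ Real.exp 2 := by
    have h1 := Real.exp_one_gt_d9
    have h2 : Real.exp 2 = Real.exp 1 ^ 2 := by rw [← Real.exp_nat_mul]; norm_num
    rw [h2]
    calc (6 : ℝ) ≤ 2.7 ^ 2 := by norm_num
      _ ≤ _ := pow_le_pow_left₀ (by norm_num) (by linarith) 2
  have hL6 : L ≤ 6 * y := by
    have h1 : L ≤ 6 * (M * H / ε * ζ) := by
      rw [hLdef]
      have : 6 * (M * H / ε * ζ) = 6 * H * M * ζ / ε := by ring
      rw [this]
      gcongr
    linarith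
  have hℓY : ℓ ≤ 3 * Y := by
    have h1 := Real.log_le_log hL0 hL6
    rw [Real.log_mul (by norm_num) hy0.ne'] at h1
    have h2 : Real.log 6 ≤ 2 := (Real.log_le_iff_le_exp (by norm_num)).2 he2
    linarith
  -- A common upper bound for the logarithms in all three sample sizes.
  set G := Real.log (12 * N * H ^ 2 * M * ℓ / δ) with hG
  have hpos : 0 < 12 * N * (H : ℝ) ^ 2 * M * ℓ / δ := by positivity
  have hG1 : 1 ≤ G := by
    rw [hG, Real.le_log_iff_exp_le hpos, le_div_iff₀ hδ]
    have h1 : 1 ≤ N * (H : ℝ) ^ 2 * M * ℓ :=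
      one_le_mul_of_one_le_of_one_le (one_le_mul_of_one_le_of_one_le
        (one_le_mul_of_one_le_of_one_le hN' (one_le_pow₀ hH')) hM') hℓ
    have h2 : Real.exp 1 * δ ≤ 3 * 1 :=
      mul_le_mul (by linarith) hδ1.le hδ.le (by norm_num)
    have h3 : 12 * N * (H : ℝ) ^ 2 * M * ℓ = 12 * (N * (H : ℝ) ^ 2 * M * ℓ) := by ring
    linarith
  -- The target contains `N ζ / δ` rather than `N / δ`, so a small `ζ` must be compensated. The
  -- assumption `e ≤ L` keeps `ζ` from being too small.
  have hinv : 1 / ζ ≤ 6 * y := by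
    have h1 : 1 ≤ L := le_trans (by have := Real.add_one_le_exp (1 : ℝ); linarith) hL
    rw [div_le_iff₀ hζ]
    have h2 : L ≤ 6 * (M * H / ε) * ζ := by
      rw [hLdef]
      have : 6 * (M * H / ε) * ζ = 6 * H * M * ζ / ε := by ring
      rw [this]
      gcongr
    have h3 : 6 * (M * H / ε) * ζ ≤ 6 * y * ζ := by
      gcongr; linarith
    linarith
  have hGle : G ≤ 23 * (W * Y) := by
    have hHM : (M : ℝ) * H ≤ y := by
      have : (M : ℝ) * H ≤ M * H / ε := by
        rw [le_div_iff₀ hε]; exact mul_le_of_le_one_right (by positivity) hε1.le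
      linarith
    have hH2 : (H : ℝ) ≤ y := (le_mul_of_one_le_left (by positivity) hM').trans hHM
    have hNδ : N / δ ≤ w * (6 * y) := by
      have h1 : N / δ = N * ζ / δ * (1 / ζ) := by field_simp
      rw [h1]
      exact mul_le_mul (by rw [hw]; linarith) hinv (by positivity) hw0.le
    have hℓL : ℓ ≤ 6 * y := (Real.log_le_self hL0.le).trans hL6
    have h1 : 12 * N * (H : ℝ) ^ 2 * M * ℓ / δ ≤ 432 * w * y ^ 4 := by
      calc 12 * N * (H : ℝ) ^ 2 * M * ℓ / δ = 12 * ((N / δ) * (H * (M * H) * ℓ)) := by ring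
        _ ≤ 12 * ((w * (6 * y)) * (y * y * (6 * y))) := by gcongr
        _ = 432 * w * y ^ 4 := by ring
    have h2 := Real.log_le_log hpos h1
    rw [Real.log_mul (by positivity) (by positivity), Real.log_mul (by norm_num) (by positivity),
      Real.log_pow] at h2
    have h3 : Real.log 432 ≤ 7 := (Real.log_le_iff_le_exp (by norm_num)).2 he7
    push_cast at h2
    have h4 := mul_le_mul_of_nonneg_right hW1 (show 0 ≤ Y by linarith)
    have h5 := mul_le_mul_of_nonneg_left hY1 (show 0 ≤ W by linarith)
    -- From `G ≤ 7 + W + 4 * Y` with `W ≥ 1/2` and `Y ≥ 1`: the terms are at most `14`, `1` and `8`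
    -- times `W * Y`.
    linarith
  have hNδ0 : 0 < (N : ℝ) / δ := by positivity
  have hx1 : Real.log (6 * N / δ) ≤ G := by
    refine Real.log_le_log (by positivity) ?_
    have h1 : 1 ≤ (H : ℝ) ^ 2 * M * ℓ :=
      one_le_mul_of_one_le_of_one_le (one_le_mul_of_one_le_of_one_le (one_le_pow₀ hH') hM') hℓ
    have e1 : 6 * N / δ = 6 * (N / δ) := by ring
    have e2 : 12 * N * (H : ℝ) ^ 2 * M * ℓ / δ = 12 * (N / δ) * ((H : ℝ) ^ 2 * M * ℓ) := by ring
    rw [e1, e2]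
    have h2 := le_mul_of_one_le_right (show 0 ≤ 12 * (N / δ) by positivity) h1
    linarith
  have hx2 : Real.log (12 * H ^ 2 * M * ℓ / δ) ≤ G := by
    refine Real.log_le_log (by positivity) ?_
    have e1 : 12 * N * (H : ℝ) ^ 2 * M * ℓ / δ = N * (12 * (H : ℝ) ^ 2 * M * ℓ / δ) := by ring
    rw [e1]
    exact le_mul_of_one_le_left (by positivity) hN'
  have hx3 : Real.log (12 * N * H * M * ℓ / δ) ≤ G := by
    refine Real.log_le_log (by positivity) ?_
    have e1 : 12 * N * (H : ℝ) ^ 2 * M * ℓ / δ = H * (12 * N * (H : ℝ) * M * ℓ / δ) := by ring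
    rw [e1]
    exact le_mul_of_one_le_left (by positivity) hH'
  set E := 1 / ε ^ 2 with hE
  have hE1 : 1 ≤ E := by
    rw [hE, le_div_iff₀ (by positivity), one_mul]
    exact pow_le_one₀ hε.le hε1.le
  have hH2 : (1 : ℝ) ≤ H ^ 2 := one_le_pow₀ hH'
  have hMK : (1 : ℝ) ≤ M * K := one_le_mul_of_one_le_of_one_le hM' hK'
  have hH2E : 1 ≤ H ^ 2 * E := one_le_mul_of_one_le_of_one_le hH2 hE1
  have hHMKE : 1 ≤ (M * K) * (H ^ 2 * E) := one_le_mul_of_one_le_of_one_le hMK hH2E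
  have n1 : ((oliverParams H K N M ζ θ η ε δ).nEst : ℝ) ≤ 33 * E * G := by
    refine (natCeil_mul_le (a := 32 / ε ^ 2) ?_ hG1 hx1).trans ?_
    · have : 32 / ε ^ 2 = 32 * E := by ring
      linarith
    · have : 32 / ε ^ 2 = 32 * E := by ring
      rw [this]
      gcongr
      linarith
  have n2 : ((oliverParams H K N M ζ θ η ε δ).nEval : ℝ) ≤ 289 * (H ^ 2 * E) * G := by
    refine (natCeil_mul_le (a := 288 * H ^ 2 / ε ^ 2) ?_ hG1 hx2).trans ?_
    · have : 288 * (H : ℝ) ^ 2 / ε ^ 2 = 288 * (H ^ 2 * E) := by ring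
      linarith
    · have : 288 * (H : ℝ) ^ 2 / ε ^ 2 = 288 * (H ^ 2 * E) := by ring
      rw [this]
      gcongr
      linarith
  have n3 : ((oliverParams H K N M ζ θ η ε δ).nExpl : ℝ) ≤
      4609 * ((M * K) * (H ^ 2 * E)) * G := by
    have e : 4608 * (H : ℝ) ^ 2 * M * K / ε ^ 2 = 4608 * ((M * K) * (H ^ 2 * E)) := by ring
    refine (natCeil_mul_le (a := 4608 * H ^ 2 * M * K / ε ^ 2) ?_ hG1 hx3).trans ?_
    · linarith
    · rw [e]
      gcongr
      linarith
  have hHMℓ : 1 ≤ H * M * ℓ :=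
    one_le_mul_of_one_le_of_one_le (one_le_mul_of_one_le_of_one_le hH' hM') hℓ
  have ht1 : (t : ℝ) + 1 ≤ 3 * (H * M * ℓ) := by linarith
  have ht2 : (t : ℝ) ≤ 2 * (H * M * ℓ) := by linarith
  unfold Oliver.episodes
  push_cast
  set D := (M : ℝ) ^ 2 * H ^ 3 * K * E * ℓ * G with hD
  have d1 : 33 * E * G ≤ 33 * D := by
    have : 1 ≤ (H * M * ℓ) * (M * K * H ^ 2) :=
      one_le_mul_of_one_le_of_one_le hHMℓ (one_le_mul_of_one_le_of_one_le hMK hH2)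
    have e : 33 * D = 33 * E * G * ((H * M * ℓ) * (M * K * H ^ 2)) := by rw [hD]; ring
    rw [e]
    exact le_mul_of_one_le_right (by positivity) this
  have d2 : 3 * (H * M * ℓ) * (289 * (H ^ 2 * E) * G) ≤ 867 * D := by
    have e : 867 * D = 3 * (H * M * ℓ) * (289 * (H ^ 2 * E) * G) * (M * K) := by rw [hD]; ring
    rw [e]
    exact le_mul_of_one_le_right (by positivity) hMK
  have d3 : 2 * (H * M * ℓ) * (4609 * ((M * K) * (H ^ 2 * E)) * G) = 9218 * D := by
    rw [hD]; ring
  have hsum : ((oliverParams H K N M ζ θ η ε δ).nEst : ℝ) +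
      (t + 1) * (oliverParams H K N M ζ θ η ε δ).nEval +
      t * (oliverParams H K N M ζ θ η ε δ).nExpl ≤ 10118 * D := by
    have a2 := mul_le_mul ht1 n2 (Nat.cast_nonneg _) (by positivity)
    have a3 := mul_le_mul ht2 n3 (Nat.cast_nonneg _) (by positivity)
    linarith
  refine hsum.trans ?_
  have hfin : ℓ * G ≤ 3 * Y * (23 * (W * Y)) :=
    mul_le_mul hℓY hGle (by linarith) (by positivity)
  have hbase : 0 ≤ (M : ℝ) ^ 2 * H ^ 3 * K * E := by positivity
  have e1 : 10118 * D = 10118 * ((M : ℝ) ^ 2 * H ^ 3 * K * E) * (ℓ * G) := by rw [hD]; ring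
  have e2 : 700000 * ((M : ℝ) ^ 2 * (H : ℝ) ^ 3 * K / ε ^ 2) * W * Y ^ 2 =
      700000 * ((M : ℝ) ^ 2 * H ^ 3 * K * E) * (W * Y ^ 2) := by ring
  rw [e1, e2]
  have hWY : 0 ≤ W * Y ^ 2 := by positivity
  calc 10118 * ((M : ℝ) ^ 2 * H ^ 3 * K * E) * (ℓ * G)
      ≤ 10118 * ((M : ℝ) ^ 2 * H ^ 3 * K * E) * (3 * Y * (23 * (W * Y))) := by gcongr
    _ = 698142 * ((M : ℝ) ^ 2 * H ^ 3 * K * E) * (W * Y ^ 2) := by ring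
    _ ≤ _ := by gcongr; norm_num

end

/-! ### The main theorem -/

theorem theorem4 :
    ∃ (c : ℝ) (k : ℕ),
      ∀ (X : Type u) (A : Type v) (F : Type w) [MeasurableSpace X] [MeasurableSpace A]
        [MeasurableSingletonClass A] [Fintype A] [DecidableEq A] [Nonempty A]
        [MeasurableSpace F] [MeasurableSingletonClass F] [Fintype F]
        (C : CDP X A) (Q : QClass X A F) (M : ℕ) (ζ η θ ε δ : ℝ),
        1 ≤ C.H → 1 ≤ M →
        ε ∈ Set.Ioo (0 : ℝ) 1 → δ ∈ Set.Ioo (0 : ℝ) 1 → θ ∈ Set.Icc (0 : ℝ) 1 →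
        C.BoundedRewards →
        C.HasBellmanFactorization Q M ζ η →
        Real.exp 1 ≤ 6 * C.H * √M * ζ / ε →
        (∃ f, C.IsValid Q θ f) →
        ∀ S : Oliver.Selection C Q
            (oliverParams C.H (Fintype.card A) (Fintype.card F) M ζ θ η ε δ),
          ∃ T : ℕ, ENNReal.ofReal (1 - δ) ≤ Oliver.runLaw S T
            {r | ∃ t : Fin T, Oliver.HaltsAt Q r t ∧
              C.optValue Q θ - (ε + 8 * C.H * √M * (θ + η)) ≤ C.value (Oliver.output Q r t) ∧
              (Oliver.episodes
                  (oliverParams C.H (Fintype.card A) (Fintype.card F) M ζ θ η ε δ) t : ℝ) ≤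
                c * ((M : ℝ) ^ 2 * (C.H : ℝ) ^ 3 * Fintype.card A / ε ^ 2) *
                  Real.log (2 + Fintype.card F * ζ / δ) *
                  Real.log (2 + M * C.H * (1 + ζ) / ε) ^ k} := by
  refine ⟨700000, 2, ?_⟩
  intro X A F _ _ _ _ _ _ _ _ _ C Q M ζ η θ ε δ hH hM hε hδ hθ hC hfac hL hvalid
  obtain ⟨hε0, hε1⟩ := hε
  obtain ⟨hδ0, hδ1⟩ := hδ
  have hF : Nonempty F := hvalid.nonempty
  have hH' : (1 : ℝ) ≤ C.H := by exact_mod_cast hH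
  have hM' : (1 : ℝ) ≤ M := by exact_mod_cast hM
  have hK' : (1 : ℝ) ≤ Fintype.card A := by exact_mod_cast Fintype.card_pos
  have hN' : (1 : ℝ) ≤ Fintype.card F := by exact_mod_cast Fintype.card_pos
  have hM2 : 1 ≤ √(M : ℝ) := Real.one_le_sqrt.2 hM'
  have hη : 0 ≤ η := by
    obtain ⟨p, b, hpb⟩ := hfac
    obtain ⟨f⟩ := hF
    exact (abs_nonneg _).trans (hpb ⟨0, hH⟩ f f).1
  set ℓ := Real.log (6 * C.H * √(M : ℝ) * ζ / ε) with hℓdef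
  have hℓ : 1 ≤ ℓ := (Real.le_log_iff_exp_le ((Real.exp_pos 1).trans_le hL)).2 hL
  have hL1 : 1 ≤ 6 * C.H * √(M : ℝ) * ζ / ε := (Real.one_le_exp zero_le_one).trans hL
  have hHMℓ : 1 ≤ (C.H : ℝ) * M * ℓ :=
    one_le_mul_of_one_le_of_one_le (one_le_mul_of_one_le_of_one_le hH' hM') hℓ
  set P := oliverParams C.H (Fintype.card A) (Fintype.card F) M ζ θ η ε δ
  intro S
  have hlog : ∀ x : ℝ, 1 ≤ x → 0 < Real.log (12 * x / δ) := fun x hx =>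
    Real.log_pos ((one_lt_div hδ0).2 (by linarith))
  have hn1 : 0 < P.nEst := Nat.ceil_pos.2 (mul_pos (by positivity)
    (Real.log_pos ((one_lt_div hδ0).2 (by linarith))))
  have hn2 : 0 < P.nEval := by
    have h := hlog (C.H * (C.H * M * ℓ)) (one_le_mul_of_one_le_of_one_le hH' hHMℓ)
    have e : 12 * (C.H * (C.H * M * ℓ)) / δ = 12 * (C.H : ℝ) ^ 2 * M * ℓ / δ := by ring
    rw [e] at h
    exact Nat.ceil_pos.2 (mul_pos (by positivity) h)
  have hn3 : 0 < P.nExpl := by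
    have h := hlog (Fintype.card F * (C.H * M * ℓ)) (one_le_mul_of_one_le_of_one_le hN' hHMℓ)
    have e : 12 * (Fintype.card F * (C.H * M * ℓ)) / δ =
      12 * (Fintype.card F : ℝ) * C.H * M * ℓ / δ := by ring
    rw [e] at h
    exact Nat.ceil_pos.2 (mul_pos (by positivity) h)
  -- One more iteration than a good run can fail the test.
  set T := ⌊2 * C.H * M * ℓ⌋₊ + 1 with hT
  have hT1 : 2 * C.H * M * ℓ < T := by
    rw [hT]; push_cast; exact Nat.lt_floor_add_one _
  have hT2 : (T : ℝ) ≤ 3 * (C.H * M * ℓ) := by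
    have := Nat.floor_le (show 0 ≤ 2 * C.H * M * ℓ by positivity)
    rw [hT]; push_cast; linarith
  refine ⟨T, ?_⟩
  have hbad := Oliver.runLaw_not_runGood_le S
    (Oliver.measure_not_estGood_le Q hε0 hδ0 hn1 (Nat.le_ceil _))
    (Oliver.evalKernel_not_evalGood_le Q hC hε0 hδ0 (zero_lt_one.trans_le hℓ) hM hH hn2
      (Nat.le_ceil _))
    (Oliver.explKernel_not_explGood_le Q hC hε0 hε1.le hδ0 hδ1.le hℓ hM hH hn3 (Nat.le_ceil _)) T
  -- With `T ≤ 3HMℓ` the budget is `δ/3 + δ/2 + δ/24`, which is below `δ`.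
  have hsum : ENNReal.ofReal (δ / 3) + T * (ENNReal.ofReal (δ / (6 * C.H * M * ℓ)) +
      ENNReal.ofReal (δ / (72 * C.H * M * ℓ))) ≤ ENNReal.ofReal δ := by
    rw [← ENNReal.ofReal_natCast, ← ENNReal.ofReal_add (by positivity) (by positivity),
      ← ENNReal.ofReal_mul (by positivity), ← ENNReal.ofReal_add (by positivity) (by positivity)]
    apply ENNReal.ofReal_le_ofReal
    have h1 : (T : ℝ) * (δ / (6 * C.H * M * ℓ) + δ / (72 * C.H * M * ℓ)) ≤
        3 * (C.H * M * ℓ) * (δ / (6 * C.H * M * ℓ) + δ / (72 * C.H * M * ℓ)) := by gcongr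
    have h2 : 3 * (C.H * M * ℓ) * (δ / (6 * C.H * M * ℓ) + δ / (72 * C.H * M * ℓ)) =
        13 / 24 * δ := by field_simp; norm_num
    linarith
  set bad := {r | ¬ Oliver.RunGood Q (ε / 8) (ε / (8 * C.H)) (ε / (12 * C.H * √(M : ℝ))) r}
  -- Subadditivity of the outer measure is enough here, so the success event need not be shown
  -- measurable.
  have hprob : ∀ G : Set (Oliver.Transcript (F := F) C P T), badᶜ ⊆ G →
      ENNReal.ofReal (1 - δ) ≤ Oliver.runLaw S T G := by
    intro G hG
    have h1 : 1 ≤ Oliver.runLaw S T G + Oliver.runLaw S T bad := by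
      rw [← measure_univ (μ := Oliver.runLaw S T)]
      refine (measure_mono fun r _ => ?_).trans (measure_union_le _ _)
      by_cases hr : r ∈ bad
      · exact Or.inr hr
      · exact Or.inl (hG hr)
    rw [ENNReal.ofReal_sub _ hδ0.le, ENNReal.ofReal_one]
    exact tsub_le_iff_right.2 (h1.trans (add_le_add_right (hbad.trans hsum) _))
  refine hprob _ fun r hr => ?_
  have hgood : Oliver.RunGood Q (ε / 8) (ε / (8 * C.H)) P.φ r := not_not.1 hr
  obtain ⟨t, ht, htle⟩ := hgood.exists_haltsAt hH hM hε0 hθ.1 hη rfl rfl hL1 hvalid hfac hT1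
  refine ⟨t, ht, ?_, episodes_oliverParams_le hH Fintype.card_pos Fintype.card_pos hM hε0 hε1 hδ0
    hδ1 hL htle⟩
  have : Nonempty {f // C.IsValid Q θ f} := nonempty_subtype.2 hvalid
  rw [sub_le_iff_le_add]
  refine ciSup_le fun f => ?_
  have hv := hgood.value_ge_of_stop hC hH f.2 ht.2.1
  -- The `ε` terms add up to exactly `ε`; the remaining ones are at most `(15/4 + 5/4) H√M(θ + η)`,
  -- so the constant `8` leaves room.
  have hgap : C.H * θ + 5 * P.εStop / 8 + 3 * ε / 8 ≤ ε + 8 * C.H * √(M : ℝ) * (θ + η) := by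
    have e : P.εStop = ε + 2 * C.H * (3 * √(M : ℝ) * (θ + η) + η) := rfl
    have h1 : C.H * θ + 5 / 4 * (C.H * η) ≤ 5 / 4 * (C.H * (θ + η)) := by
      have : 0 ≤ C.H * θ := mul_nonneg (by positivity) hθ.1
      linarith
    have h2 : (C.H : ℝ) * (θ + η) ≤ √(M : ℝ) * (C.H * (θ + η)) :=
      le_mul_of_one_le_left (mul_nonneg (by positivity) (add_nonneg hθ.1 hη)) hM2
    have h3 : 0 ≤ (C.H : ℝ) * (θ + η) := mul_nonneg (by positivity) (add_nonneg hθ.1 hη)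
    rw [e]
    linarith
  have hv' : C.value (Q.greedy f) - (C.H * θ + 5 * P.εStop / 8 + 3 * ε / 8) ≤
      C.value (Oliver.output Q r t) := hv
  linarith
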